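/- Let $M$ be a finite-dimensional smooth manifold and let $A\subset TM\setminus\mathbf 0$ be open in $TM$, conic ($\lambda v\in A$ for $v\in A$, $\lambda>0$) and with $A\cap T_pM\neq\emptyset$ for every $p\in M$. Let $L:A\to\mathbb R$ be a pseudo-Finsler metric: $L$ is smooth, $L(\lambda v)=\lambda^2L(v)$ for $v\in A$, $\lambda>0$, and for every $v\in A$ the fundamental tensor $g_v(u,w)=\frac12\frac{\partial^2}{\partial t\,\partial s}L(v+tu+sw)|_{t=s=0}$ ($u,w\in T_{\pi(v)}M$) is nondegenerate. Let $C_v(w_1,w_2,w_3)=\frac14\frac{\partial^3}{\partial s_3\partial s_2\partial s_1}L(v+\sum_i s_iw_i)|_{s=0}$ be the Cartan tensor, and for a local vector field $V$ with values in $A$ let $\nabla^V$ be the Chern connection, i.e. the unique affine connection with $\nabla^V_XY-\nabla^V_YX=[X,Y]$ and $X(g_V(Y,Z))=g_V(\nabla^V_XY,Z)+g_V(Y,\nabla^V_XZ)+2C_V(\nabla^V_XV,Y,Z)$; its Christoffel symbols in a chart at a point depend only on the value of $V$ there, and are written $\Gamma^k_{ij}(V)$. For a curve $\gamma$ and vector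 fields $W,X$ along $\gamma$ with $W(t)\in A$ put $D^W_\gamma X=\big(\dot X^k+X^i\dot\gamma^j\,\Gamma^k_{ij}(W)\big)\,\partial_k$ in a chart. A geodesic is a smooth curve $\gamma$ with $\dot\gamma(t)\in A$ for all $t$ and $D^{\dot\gamma}_\gamma\dot\gamma=0$. The Legendre transformation is $\mathscr L_L:A\to TM^*$, $\mathscr L_L(v)=g_v(v,\cdot)\in T^*_{\pi(v)}M$. Let $P,Q\subset M$ be (embedded) submanifolds and $a<b$. Let $C_L(P,Q)$ be the set of piecewise smooth curves $\gamma:[a,b]\to M$ with $\gamma(a)\in P$, $\gamma(b)\in Q$ whose velocities (both one-sided velocities at breaks) lie in $A$. For $\gamma\in C_L(P,Q)$ with breaks $a=t_0<t_1<\dots<t_h<t_{h+1}=b$, let $T_\gamma C_L(P,Q)$ be the set of continuous vector fields $W$ along $\gamma$ that are smooth on each $[t_i,t_{i+1}]$, with $W(a)\in T_{\gamma(a)}P$ and $W(b)\in T_{\gamma(b)}Q$. The differential at $\gamma$ of the energy functional $E(\gamma)=\frac12\int_a^bL(\dot\gamma)\,dt$ is defined, through the first variation formula, as $$dE_\gamma(W)=-\int_a^b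 g_{\dot\gamma}(W,D^{\dot\gamma}_\gamma\dot\gamma)\,dt+\big[g_{\dot\gamma}(W,\dot\gamma)\big]_a^b-\sum_{i=1}^h\Big(\mathscr L_L(\dot\gamma(t_i^+))(W(t_i))-\mathscr L_L(\dot\gamma(t_i^-))(W(t_i))\Big),$$ and $\gamma$ is called a critical point of $E|_{C_L(P,Q)}$ if $dE_\gamma(W)=0$ for every $W\in T_\gamma C_L(P,Q)$. Assume that $\mathscr L_L$ is injective, and let $\gamma\in C_L(P,Q)$. Then $\gamma$ is a critical point of $E|_{C_L(P,Q)}$ if and only if $\gamma$ is a geodesic on $[a,b]$ with $g_{\dot\gamma(a)}(\dot\gamma(a),w)=0$ for every $w\in T_{\gamma(a)}P$ and $g_{\dot\gamma(b)}(\dot\gamma(b),w)=0$ for every $w\in T_{\gamma(b)}Q$. -/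

import Mathlib

open scoped Manifold ContDiff Topology
open Set Bundle

namespace PseudoFinsler

noncomputable section

section Metric

variable {E : Type*} [NormedAddCommGroup E] [NormedSpace ℝ E]
  {M : Type*} [TopologicalSpace M] [ChartedSpace E M]

/-- The fundamental tensor of a function `L` on the tangent bundle at a tangent vector `v`:
`g_v(u, w) = (1/2) ∂²/∂t∂s L(v + t u + s w)` at `t = s = 0`. -/
def fundamentalTensor (L : TangentBundle 𝓘(ℝ, E) M → ℝ) (v : TangentBundle 𝓘(ℝ, E) M)
    (u w : TangentSpace 𝓘(ℝ, E) v.proj) : ℝ :=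
  (1 / 2) * deriv (fun t : ℝ => deriv (fun s : ℝ => L ⟨v.proj, v.snd + t • u + s • w⟩) 0) 0

/-- The Cartan tensor of a function `L` on the tangent bundle at a tangent vector `v`:
`C_v(w₁, w₂, w₃) = (1/4) ∂³/∂s₃∂s₂∂s₁ L(v + s₁ w₁ + s₂ w₂ + s₃ w₃)` at `s₁ = s₂ = s₃ = 0`. -/
def cartanTensor (L : TangentBundle 𝓘(ℝ, E) M → ℝ) (v : TangentBundle 𝓘(ℝ, E) M)
    (w₁ w₂ w₃ : TangentSpace 𝓘(ℝ, E) v.proj) : ℝ :=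
  (1 / 4) * deriv (fun s₃ : ℝ => deriv (fun s₂ : ℝ => deriv (fun s₁ : ℝ =>
    L ⟨v.proj, v.snd + s₁ • w₁ + s₂ • w₂ + s₃ • w₃⟩) 0) 0) 0

variable (E M) in
/-- A (conic, two-homogeneous) pseudo-Finsler metric on `M`: a smooth function `L`, defined on an
open conic set `A` of non-zero tangent vectors that meets every tangent space, positively
homogeneous of degree two, with nondegenerate fundamental tensor at every `v ∈ A`.
The values of `L` outside `A` are irrelevant. -/
structure PseudoFinslerMetric [IsManifold 𝓘(ℝ, E) ∞ M] where
  /-- the conic domain `A ⊆ TM ∖ 0` -/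
  domain : Set (TangentBundle 𝓘(ℝ, E) M)
  /-- the function `L` -/
  toFun : TangentBundle 𝓘(ℝ, E) M → ℝ
  isOpen_domain : IsOpen domain
  zero_notMem : ∀ p : M, (⟨p, 0⟩ : TangentBundle 𝓘(ℝ, E) M) ∉ domain
  exists_mem : ∀ p : M, ∃ v : TangentSpace 𝓘(ℝ, E) p,
    (⟨p, v⟩ : TangentBundle 𝓘(ℝ, E) M) ∈ domain
  smul_mem : ∀ v ∈ domain, ∀ c : ℝ, 0 < c →
    (⟨v.proj, c • v.snd⟩ : TangentBundle 𝓘(ℝ, E) M) ∈ domain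
  smooth : ContMDiffOn 𝓘(ℝ, E).tangent 𝓘(ℝ, ℝ) ∞ toFun domain
  homogeneous : ∀ v ∈ domain, ∀ c : ℝ, 0 < c → toFun ⟨v.proj, c • v.snd⟩ = c ^ 2 * toFun v
  nondegenerate : ∀ v ∈ domain, ∀ u : TangentSpace 𝓘(ℝ, E) v.proj,
    (∀ w : TangentSpace 𝓘(ℝ, E) v.proj, fundamentalTensor toFun v u w = 0) → u = 0

variable [IsManifold 𝓘(ℝ, E) ∞ M]

/-- The fundamental tensor `g_v` of a pseudo-Finsler metric. -/
def PseudoFinslerMetric.g (L : PseudoFinslerMetric E M) (v : TangentBundle 𝓘(ℝ, E) M)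
    (u w : TangentSpace 𝓘(ℝ, E) v.proj) : ℝ :=
  fundamentalTensor L.toFun v u w

/-- The Cartan tensor `C_v` of a pseudo-Finsler metric. -/
def PseudoFinslerMetric.cartan (L : PseudoFinslerMetric E M) (v : TangentBundle 𝓘(ℝ, E) M)
    (w₁ w₂ w₃ : TangentSpace 𝓘(ℝ, E) v.proj) : ℝ :=
  cartanTensor L.toFun v w₁ w₂ w₃

/-- The Legendre transformation `v ↦ g_v(v, ·)`, a one-form at the base point of `v`. -/
def PseudoFinslerMetric.legendre (L : PseudoFinslerMetric E M) (v : TangentBundle 𝓘(ℝ, E) M) :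
    Σ p : M, (TangentSpace 𝓘(ℝ, E) p → ℝ) :=
  ⟨v.proj, fun w => L.g v v.snd w⟩

/-! ### Coordinates on the tangent bundle -/

/-- The tangent vector at the point with coordinates `z` (in the preferred chart at `p`) whose
components in the coordinate frame of that chart are `y`. -/
def fromCoord (p : M) (z y : E) : TangentBundle 𝓘(ℝ, E) M :=
  ⟨(extChartAt 𝓘(ℝ, E) p).symm z,
    (trivializationAt E (TangentSpace 𝓘(ℝ, E)) p).symmL ℝ ((extChartAt 𝓘(ℝ, E) p).symm z) y⟩

/-- The components of a tangent vector in the coordinate frame of the preferred chart at `p`. -/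
def toCoord (p : M) (v : TangentBundle 𝓘(ℝ, E) M) : E :=
  (trivializationAt E (TangentSpace 𝓘(ℝ, E)) p v).2

/-- The fundamental tensor in coordinates: `g_v(u, w)` for the vectors with the given components
at the point with coordinates `z`, where `v` has components `y`. -/
def PseudoFinslerMetric.gCoord (L : PseudoFinslerMetric E M) (p : M) (z y u w : E) : ℝ :=
  L.g (fromCoord p z y) (fromCoord p z u).snd (fromCoord p z w).snd

/-- The Cartan tensor in coordinates. -/
def PseudoFinslerMetric.cartanCoord (L : PseudoFinslerMetric E M) (p : M)
    (z y w₁ w₂ w₃ : E) : ℝ :=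
  L.cartan (fromCoord p z y) (fromCoord p z w₁).snd (fromCoord p z w₂).snd (fromCoord p z w₃).snd

/-- The value at the point with coordinates `z` of `∇_X Y`, where `∇` is the affine connection
whose Christoffel symbols at that point are `Γ`; all vector fields are written in coordinates. -/
def nablaCoord (Γ : E →ₗ[ℝ] E →ₗ[ℝ] E) (z : E) (X Y : E → E) : E :=
  fderiv ℝ Y z (X z) + Γ (X z) (Y z)

/-- `Γ` is the bilinear map of Christoffel symbols, at the tangent vector with coordinates
`(z, y)` in the preferred chart at `p`, of the Chern connection: for all vector fields
`V`, `X`, `Y`, `Z` (written in coordinates) such that `V` takes the value `y` at `z`,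
the connection `∇ = ∇^V` satisfies, at `z`,
* `∇_X Y - ∇_Y X = [X, Y]`;
* `X (g_V(Y, Z)) = g_V(∇_X Y, Z) + g_V(Y, ∇_X Z) + 2 C_V(∇_X V, Y, Z)`. -/
structure PseudoFinslerMetric.IsChernChristoffel (L : PseudoFinslerMetric E M) (p : M) (z y : E)
    (Γ : E →ₗ[ℝ] E →ₗ[ℝ] E) : Prop where
  torsion_free : ∀ X Y : E → E, ContDiffAt ℝ ∞ X z → ContDiffAt ℝ ∞ Y z →
    nablaCoord Γ z X Y - nablaCoord Γ z Y X = VectorField.lieBracket ℝ X Y z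
  almost_compatible : ∀ V X Y Z : E → E, ContDiffAt ℝ ∞ V z → ContDiffAt ℝ ∞ X z →
    ContDiffAt ℝ ∞ Y z → ContDiffAt ℝ ∞ Z z → V z = y →
    fderiv ℝ (fun x => L.gCoord p x (V x) (Y x) (Z x)) z (X z) =
      L.gCoord p z y (nablaCoord Γ z X Y) (Z z) + L.gCoord p z y (Y z) (nablaCoord Γ z X Z)
        + 2 * L.cartanCoord p z y (nablaCoord Γ z X V) (Y z) (Z z)

end Metric

/-- The pointwise linear algebra behind the existence and uniqueness of the Chern connection. -/
theorem existsUnique_chern_algebra {E : Type*} [AddCommGroup E] [Module ℝ E]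
    [FiniteDimensional ℝ E] (g : E →ₗ[ℝ] E →ₗ[ℝ] ℝ) (C T : E →ₗ[ℝ] E →ₗ[ℝ] E →ₗ[ℝ] ℝ) (y : E)
    (hg : ∀ u w, g u w = g w u) (hnd : ∀ u, (∀ w, g u w = 0) → u = 0)
    (hC₁ : ∀ a b c, C a b c = C b a c) (hC₂ : ∀ a b c, C a b c = C a c b)
    (hT : ∀ a b c, T a b c = T a c b) (hCy : ∀ b c, C y b c = 0) :
    ∃! Γ : E →ₗ[ℝ] E →ₗ[ℝ] E, (∀ a b, Γ a b = Γ b a) ∧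
      ∀ a b c, T a b c = g (Γ a b) c + g b (Γ a c) + 2 * C (Γ a y) b c := by
  have hCy₂ : ∀ b c, C b y c = 0 := fun b c => by rw [hC₁, hCy]
  have hCy₃ : ∀ b c, C b c y = 0 := fun b c => by rw [hC₂, hCy₂]
  have hnd' : LinearMap.BilinForm.Nondegenerate g := by
    refine ⟨fun u hu => hnd u hu, fun u hu => hnd u fun w => ?_⟩
    rw [hg]; exact hu w
  let sh : (E →ₗ[ℝ] ℝ) ≃ₗ[ℝ] E := (LinearMap.BilinForm.toDual g hnd').symm
  have hsh : ∀ α w, g (sh α) w = α w := fun α w =>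
    LinearMap.BilinForm.apply_toDual_symm_apply (hB := hnd') α w
  have inj : ∀ u v, (∀ w, g u w = g v w) → u = v := fun u v huv =>
    sub_eq_zero.1 (hnd _ fun w => by rw [map_sub, LinearMap.sub_apply, huv w, sub_self])
  let G : E := sh (T y y - (1 / 2 : ℝ) • (T.flip y).flip y)
  let N : E →ₗ[ℝ] E := sh.toLinearMap ∘ₗ
    ((1 / 2 : ℝ) • (T y + T.flip y - ((LinearMap.flip (T.flip y)))) - C G)
  let Γ : E →ₗ[ℝ] E →ₗ[ℝ] E := LinearMap.mk₂ ℝ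
    (fun a b => sh ((1 / 2 : ℝ) • (T a b + T b a - (T.flip a).flip b)
      - C (N a) b - C (N b) a + ((C.comp N).flip a).flip b))
    (fun a a' b => by rw [← map_add]; congr 1; ext w; simp; ring)
    (fun c a b => by rw [← map_smul]; congr 1; ext w; simp; ring)
    (fun a b b' => by rw [← map_add]; congr 1; ext w; simp; ring)
    (fun c a b => by rw [← map_smul]; congr 1; ext w; simp; ring)
  have hG : ∀ w, g G w = T y y w - 1 / 2 * T w y y := fun w => by
    simp only [G, hsh]; simp
  have hN : ∀ b w, g (N b) w = 1 / 2 * (T y b w + T b y w - T w y b) - C G b w := fun b w => by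
    simp only [N, LinearMap.comp_apply, LinearEquiv.coe_coe, hsh]; simp
  have hΓ : ∀ a b w, g (Γ a b) w = 1 / 2 * (T a b w + T b a w - T w a b)
      - C (N a) b w - C (N b) a w + C (N w) a b := fun a b w => by
    simp only [Γ, LinearMap.mk₂_apply, hsh]; simp
  have hNy : N y = G := inj _ _ fun w => by rw [hN, hG, hCy₂]; ring
  have hΓy : ∀ a, Γ a y = N a := fun a => inj _ _ fun w => by
    rw [hΓ, hN, hNy, hCy₂, hCy₃, hT w a y]; ring
  refine ⟨Γ, ⟨fun a b => inj _ _ fun w => ?_, fun a b c => ?_⟩, ?_⟩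
  · rw [hΓ, hΓ, hT w a b, hC₂ (N w) a b]; ring
  · rw [hg b, hΓ, hΓ, hΓy, hT a c b, hT c a b, hT b a c, hC₂ (N a) c b, hC₂ (N c) a b,
      hC₂ (N b) a c]; ring
  · rintro Γ' ⟨hs, hc⟩
    have key : ∀ a b w, g (Γ' a b) w = 1 / 2 * (T a b w + T b a w - T w a b)
        - C (Γ' a y) b w - C (Γ' b y) a w + C (Γ' w y) a b := fun a b w => by
      have h1 := hc a b w
      have h2 := hc b a w
      have h3 := hc w a b
      have e₁ := hg b (Γ' a w)
      have e₂ := hg a (Γ' b w)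
      rw [hs b a] at h2
      rw [hs w a, hs w b] at h3
      linarith
    have k1 : Γ' y y = G := inj _ _ fun w => by
      rw [key, hG, hCy₂, hCy₂]; ring
    have k2 : ∀ a, Γ' a y = N a := fun a => inj _ _ fun w => by
      rw [key, hN, k1, hCy₂, hCy₃, hT w a y]; ring
    refine LinearMap.ext fun a => LinearMap.ext fun b => inj _ _ fun w => ?_
    rw [key, hΓ, k2, k2, k2]

section Calculus

variable {X : Type*} [NormedAddCommGroup X] [NormedSpace ℝ X] {G : X → ℝ} {U : Set X}

theorem two_le_infty : (2 : WithTop ℕ∞) ≤ ∞ := by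
  exact WithTop.coe_le_coe.2 (le_top : (2 : ℕ∞) ≤ ⊤)

theorem contDiffOn_fderiv_infty {Y : Type*} [NormedAddCommGroup Y] [NormedSpace ℝ Y] {H : X → Y}
    (hU : IsOpen U) (hH : ContDiffOn ℝ ∞ H U) : ContDiffOn ℝ ∞ (fderiv ℝ H) U :=
  hH.fderiv_of_isOpen hU (by simp)

theorem differentiableAt_of_mem {Y : Type*} [NormedAddCommGroup Y] [NormedSpace ℝ Y] {H : X → Y}
    (hU : IsOpen U) (hH : ContDiffOn ℝ ∞ H U) {q : X} (hq : q ∈ U) : DifferentiableAt ℝ H q :=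
  (hH.contDiffAt (hU.mem_nhds hq)).differentiableAt (by simp)

theorem hasFDerivAt_of_mem {Y : Type*} [NormedAddCommGroup Y] [NormedSpace ℝ Y] {H : X → Y}
    (hU : IsOpen U) (hH : ContDiffOn ℝ ∞ H U) {q : X} (hq : q ∈ U) :
    HasFDerivAt H (fderiv ℝ H q) q :=
  (differentiableAt_of_mem hU hH hq).hasFDerivAt

theorem eventually_line_mem (hU : IsOpen U) {q : X} (hq : q ∈ U) (u : X) :
    ∀ᶠ t : ℝ in 𝓝 0, q + t • u ∈ U := by
  have : ContinuousAt (fun t : ℝ => q + t • u) 0 := by fun_prop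
  exact this (hU.mem_nhds (by simpa using hq))

theorem deriv_line (hU : IsOpen U) (hG : ContDiffOn ℝ ∞ G U) {q : X} (hq : q ∈ U) (u : X) :
    deriv (fun t : ℝ => G (q + t • u)) 0 = fderiv ℝ G q u :=
  (differentiableAt_of_mem hU hG hq).lineDeriv_eq_fderiv

theorem deriv_line₂ (hU : IsOpen U) (hG : ContDiffOn ℝ ∞ G U) {q : X} (hq : q ∈ U) (u w : X) :
    deriv (fun t : ℝ => deriv (fun s : ℝ => G (q + t • u + s • w)) 0) 0
      = fderiv ℝ (fderiv ℝ G) q u w := by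
  have h1 : (fun t : ℝ => deriv (fun s : ℝ => G (q + t • u + s • w)) 0)
      =ᶠ[𝓝 0] fun t => fderiv ℝ G (q + t • u) w := by
    filter_upwards [eventually_line_mem hU hq u] with t ht
    exact deriv_line hU hG ht w
  have hG1 := contDiffOn_fderiv_infty hU hG
  rw [h1.deriv_eq, deriv_line (G := fun x => fderiv ℝ G x w) hU (hG1.clm_apply contDiffOn_const) hq,
    fderiv_clm_apply (differentiableAt_of_mem hU hG1 hq) (differentiableAt_const _)]
  simp

theorem deriv_line₃ (hU : IsOpen U) (hG : ContDiffOn ℝ ∞ G U) {q : X} (hq : q ∈ U) (a b c : X) :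
    deriv (fun r : ℝ => deriv (fun t : ℝ => deriv (fun s : ℝ =>
      G (q + s • a + t • b + r • c)) 0) 0) 0
      = fderiv ℝ (fderiv ℝ (fderiv ℝ G)) q c b a := by
  have h1 : (fun r : ℝ => deriv (fun t : ℝ => deriv (fun s : ℝ =>
      G (q + s • a + t • b + r • c)) 0) 0)
      =ᶠ[𝓝 0] fun r => fderiv ℝ (fderiv ℝ G) (q + r • c) b a := by
    filter_upwards [eventually_line_mem hU hq c] with r hr
    rw [← deriv_line₂ hU hG hr b a]
    congr 1; funext t; congr 1; funext s; congr 1; abel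
  have hG1 := contDiffOn_fderiv_infty hU hG
  have hG2 := contDiffOn_fderiv_infty hU hG1
  have hd := differentiableAt_of_mem hU hG2 hq
  rw [h1.deriv_eq, deriv_line (G := fun x => fderiv ℝ (fderiv ℝ G) x b a) hU
    ((hG2.clm_apply contDiffOn_const).clm_apply contDiffOn_const) hq,
    fderiv_clm_apply (hd.clm_apply (differentiableAt_const _)) (differentiableAt_const _),
    fderiv_clm_apply hd (differentiableAt_const _)]
  simp

theorem fderiv₂_symm (hU : IsOpen U) (hG : ContDiffOn ℝ ∞ G U) {q : X} (hq : q ∈ U) (a b : X) :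
    fderiv ℝ (fderiv ℝ G) q a b = fderiv ℝ (fderiv ℝ G) q b a :=
  ((hG.contDiffAt (hU.mem_nhds hq)).isSymmSndFDerivAt
    (by simpa using two_le_infty)) a b

theorem fderiv₃_symm₂₃ (hU : IsOpen U) (hG : ContDiffOn ℝ ∞ G U) {q : X} (hq : q ∈ U)
    (a b c : X) : fderiv ℝ (fderiv ℝ (fderiv ℝ G)) q a b c
      = fderiv ℝ (fderiv ℝ (fderiv ℝ G)) q a c b := by
  have hd := differentiableAt_of_mem hU
    (contDiffOn_fderiv_infty hU (contDiffOn_fderiv_infty hU hG)) hq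
  have h (b c : X) : fderiv ℝ (fderiv ℝ (fderiv ℝ G)) q a b c
      = fderiv ℝ (fun x => fderiv ℝ (fderiv ℝ G) x b c) q a := by
    rw [fderiv_clm_apply (hd.clm_apply (differentiableAt_const _)) (differentiableAt_const _),
      fderiv_clm_apply hd (differentiableAt_const _)]
    simp
  rw [h b c, h c b]
  have : (fun x => fderiv ℝ (fderiv ℝ G) x b c) =ᶠ[𝓝 q] fun x => fderiv ℝ (fderiv ℝ G) x c b := by
    filter_upwards [hU.mem_nhds hq] with x hx using fderiv₂_symm hU hG hx b c
  rw [this.fderiv_eq]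

theorem fderiv₃_symm₁₂ (hU : IsOpen U) (hG : ContDiffOn ℝ ∞ G U) {q : X} (hq : q ∈ U)
    (a b c : X) : fderiv ℝ (fderiv ℝ (fderiv ℝ G)) q a b c
      = fderiv ℝ (fderiv ℝ (fderiv ℝ G)) q b a c := by
  have := (((contDiffOn_fderiv_infty hU hG).contDiffAt (hU.mem_nhds hq)).isSymmSndFDerivAt
    (by simpa using two_le_infty)) a b
  rw [this]

theorem fderiv_half_bilin {Y : Type*} [NormedAddCommGroup Y] [NormedSpace ℝ Y]
    (hU : IsOpen U) (hG : ContDiffOn ℝ ∞ G U) {c u w : Y → X} {c' u' w' : Y →L[ℝ] X} {z : Y}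
    (hc : HasFDerivAt c c' z) (hu : HasFDerivAt u u' z) (hw : HasFDerivAt w w' z)
    (hz : c z ∈ U) (ξ : Y) :
    fderiv ℝ (fun x => 1 / 2 * fderiv ℝ (fderiv ℝ G) (c x) (u x) (w x)) z ξ =
      1 / 2 * (fderiv ℝ (fderiv ℝ G) (c z) (u z) (w' ξ)
        + (fderiv ℝ (fderiv ℝ G) (c z) (u' ξ) (w z)
          + fderiv ℝ (fderiv ℝ (fderiv ℝ G)) (c z) (c' ξ) (u z) (w z))) := by
  have h2 := hasFDerivAt_of_mem hU
    (contDiffOn_fderiv_infty hU (contDiffOn_fderiv_infty hU hG)) hz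
  have hd := (((h2.comp z hc).clm_apply hu).clm_apply hw).const_mul (1 / 2 : ℝ)
  exact congrArg (fun T : Y →L[ℝ] ℝ => T ξ) hd.fderiv

/-- The bilinear form `(1/2) B(i u, i w)`. -/
def bilinOf {Y : Type*} [AddCommGroup Y] [Module ℝ Y] (B : X →L[ℝ] X →L[ℝ] ℝ) (i : Y →ₗ[ℝ] X) :
    Y →ₗ[ℝ] Y →ₗ[ℝ] ℝ :=
  LinearMap.mk₂ ℝ (fun u w => 1 / 2 * B (i u) (i w))
    (fun a b c => by simp; ring) (fun a b c => by simp; ring)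
    (fun a b c => by simp; ring) (fun a b c => by simp; ring)

theorem trilin_add (B : X →L[ℝ] X →L[ℝ] X →L[ℝ] ℝ) (a b u w : X) :
    B (a + b) u w = B a u w + B b u w := by
  rw [B.map_add]; rfl

theorem trilin_smul (B : X →L[ℝ] X →L[ℝ] X →L[ℝ] ℝ) (r : ℝ) (a u w : X) :
    B (r • a) u w = r * B a u w := by
  rw [B.map_smul]; rfl

/-- The trilinear form `c B(j a, i u, i w)`. -/
def trilinOf {Y : Type*} [AddCommGroup Y] [Module ℝ Y] (B : X →L[ℝ] X →L[ℝ] X →L[ℝ] ℝ)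
    (i j : Y →ₗ[ℝ] X) (c : ℝ) : Y →ₗ[ℝ] Y →ₗ[ℝ] Y →ₗ[ℝ] ℝ where
  toFun a := (2 * c) • bilinOf (B (j a)) i
  map_add' a b := by
    ext u w
    simp only [bilinOf, LinearMap.smul_apply, LinearMap.add_apply, LinearMap.mk₂_apply, j.map_add,
      trilin_add, smul_eq_mul]
    ring
  map_smul' r a := by
    ext u w
    simp only [bilinOf, LinearMap.smul_apply, LinearMap.mk₂_apply, j.map_smul, trilin_smul,
      smul_eq_mul, RingHom.id_apply]
    ring

theorem trilinOf_apply {Y : Type*} [AddCommGroup Y] [Module ℝ Y]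
    (B : X →L[ℝ] X →L[ℝ] X →L[ℝ] ℝ) (i j : Y →ₗ[ℝ] X) (c : ℝ) (a u w : Y) :
    trilinOf B i j c a u w = c * B (j a) (i u) (i w) := by
  change 2 * c * (1 / 2 * B (j a) (i u) (i w)) = _
  ring

end Calculus

section Existence

variable {E : Type*} [NormedAddCommGroup E] [NormedSpace ℝ E]
  {M : Type*} [TopologicalSpace M] [ChartedSpace E M] [IsManifold 𝓘(ℝ, E) ∞ M]

/-- `L` in coordinates. -/
def PseudoFinslerMetric.coordFun (L : PseudoFinslerMetric E M) (p : M) (q : E × E) : ℝ :=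
  L.toFun (fromCoord p q.1 q.2)

/-- The domain of `L` in coordinates. -/
def PseudoFinslerMetric.coordDomain (L : PseudoFinslerMetric E M) (p : M) : Set (E × E) :=
  {q | q.1 ∈ (extChartAt 𝓘(ℝ, E) p).target ∧ fromCoord p q.1 q.2 ∈ L.domain}

theorem mem_baseSet_of_mem_target (p : M) {z : E} (hz : z ∈ (extChartAt 𝓘(ℝ, E) p).target) :
    (extChartAt 𝓘(ℝ, E) p).symm z ∈
      (trivializationAt E (TangentSpace 𝓘(ℝ, E)) p).baseSet := by
  rw [TangentBundle.trivializationAt_baseSet]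
  simpa using (extChartAt 𝓘(ℝ, E) p).map_target hz

theorem fromCoord_eq (p : M) (q : E × E) (hq : q.1 ∈ (extChartAt 𝓘(ℝ, E) p).target) :
    fromCoord p q.1 q.2
      = (extChartAt (𝓘(ℝ, E).prod 𝓘(ℝ, E)) (⟨p, 0⟩ : TangentBundle 𝓘(ℝ, E) M)).symm q := by
  have hb := mem_baseSet_of_mem_target p hq
  have := Trivialization.mk_symm (trivializationAt E (TangentSpace 𝓘(ℝ, E)) p) hb q.2
  rw [FiberBundle.extChartAt, PartialEquiv.trans_symm_eq_symm_trans_symm]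
  rw [← Trivialization.symmL_apply (R := ℝ) _ hb] at this
  exact this

theorem mem_extChart_tangent_target (p : M) (q : E × E) :
    q ∈ (extChartAt (𝓘(ℝ, E).prod 𝓘(ℝ, E)) (⟨p, 0⟩ : TangentBundle 𝓘(ℝ, E) M)).target ↔
      q.1 ∈ (extChartAt 𝓘(ℝ, E) p).target := by
  rw [FiberBundle.extChartAt_target]
  exact ⟨fun h => h.1.1, fun h => ⟨⟨h, mem_baseSet_of_mem_target p h⟩, trivial⟩⟩

theorem PseudoFinslerMetric.coordDomain_eq (L : PseudoFinslerMetric E M) (p : M) :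
    L.coordDomain p =
      (extChartAt (𝓘(ℝ, E).prod 𝓘(ℝ, E)) (⟨p, 0⟩ : TangentBundle 𝓘(ℝ, E) M)).target ∩
      (extChartAt (𝓘(ℝ, E).prod 𝓘(ℝ, E)) (⟨p, 0⟩ : TangentBundle 𝓘(ℝ, E) M)).symm ⁻¹'
        L.domain := by
  ext q
  rw [mem_inter_iff, mem_extChart_tangent_target, mem_preimage]
  refine and_congr_right fun h => ?_
  rw [fromCoord_eq p q h]

theorem PseudoFinslerMetric.isOpen_coordDomain (L : PseudoFinslerMetric E M) (p : M) :
    IsOpen (L.coordDomain p) := by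
  rw [L.coordDomain_eq p]
  exact (continuousOn_extChartAt_symm _).isOpen_inter_preimage (isOpen_extChartAt_target _)
    L.isOpen_domain

theorem PseudoFinslerMetric.contDiffOn_coordFun (L : PseudoFinslerMetric E M) (p : M) :
    ContDiffOn ℝ ∞ (L.coordFun p) (L.coordDomain p) := by
  have h := L.smooth.comp ((contMDiffOn_extChartAt_symm (I := 𝓘(ℝ, E).prod 𝓘(ℝ, E)) (n := ∞)
    (⟨p, 0⟩ : TangentBundle 𝓘(ℝ, E) M)).mono
      (inter_subset_left (t := (extChartAt (𝓘(ℝ, E).prod 𝓘(ℝ, E))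
        (⟨p, 0⟩ : TangentBundle 𝓘(ℝ, E) M)).symm ⁻¹' L.domain))) inter_subset_right
  rw [← L.coordDomain_eq p] at h
  rw [← contMDiffOn_iff_contDiffOn]
  refine ContMDiffOn.congr h fun q hq => ?_
  simp only [PseudoFinslerMetric.coordFun, Function.comp, fromCoord_eq p q hq.1]


theorem PseudoFinslerMetric.gCoord_eq (L : PseudoFinslerMetric E M) (p : M) {z y : E}
    (h : (z, y) ∈ L.coordDomain p) (u w : E) :
    L.gCoord p z y u w =
      1 / 2 * fderiv ℝ (fderiv ℝ (L.coordFun p)) (z, y) (0, u) (0, w) := by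
  rw [← deriv_line₂ (L.isOpen_coordDomain p) (L.contDiffOn_coordFun p) h]
  have hq : ∀ t s : ℝ, (z, y) + t • ((0 : E), u) + s • ((0 : E), w) = (z, y + t • u + s • w) := by
    simp
  let S := (trivializationAt E (TangentSpace 𝓘(ℝ, E)) p).symmL ℝ
    ((extChartAt 𝓘(ℝ, E) p).symm z)
  have hS : ∀ t s : ℝ, S (y + t • u + s • w) = S y + t • S u + s • S w := fun t s => by
    rw [map_add, map_add, map_smul, map_smul]
  have hL : ∀ t s : ℝ, L.coordFun p ((z, y) + t • ((0 : E), u) + s • ((0 : E), w))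
      = L.toFun ⟨(extChartAt 𝓘(ℝ, E) p).symm z, S y + t • S u + s • S w⟩ := fun t s => by
    rw [hq, ← hS]; rfl
  simp only [hL]
  rfl

theorem PseudoFinslerMetric.cartanCoord_eq (L : PseudoFinslerMetric E M) (p : M) {z y : E}
    (h : (z, y) ∈ L.coordDomain p) (a b c : E) :
    L.cartanCoord p z y a b c =
      1 / 4 * fderiv ℝ (fderiv ℝ (fderiv ℝ (L.coordFun p))) (z, y) (0, c) (0, b) (0, a) := by
  rw [← deriv_line₃ (L.isOpen_coordDomain p) (L.contDiffOn_coordFun p) h]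
  have hq : ∀ s t r : ℝ, (z, y) + s • ((0 : E), a) + t • ((0 : E), b) + r • ((0 : E), c)
      = (z, y + s • a + t • b + r • c) := by
    simp
  let S := (trivializationAt E (TangentSpace 𝓘(ℝ, E)) p).symmL ℝ
    ((extChartAt 𝓘(ℝ, E) p).symm z)
  have hS : ∀ s t r : ℝ, S (y + s • a + t • b + r • c) = S y + s • S a + t • S b + r • S c :=
    fun s t r => by rw [map_add, map_add, map_add, map_smul, map_smul, map_smul]
  have hL : ∀ s t r : ℝ,
      L.coordFun p ((z, y) + s • ((0 : E), a) + t • ((0 : E), b) + r • ((0 : E), c))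
      = L.toFun ⟨(extChartAt 𝓘(ℝ, E) p).symm z, S y + s • S a + t • S b + r • S c⟩ :=
    fun s t r => by rw [hq, ← hS]; rfl
  simp only [hL]
  rfl

theorem PseudoFinslerMetric.gCoord_nondegenerate (L : PseudoFinslerMetric E M) (p : M) {z y : E}
    (h : (z, y) ∈ L.coordDomain p) {u : E} (hu : ∀ w, L.gCoord p z y u w = 0) : u = 0 := by
  have hb := mem_baseSet_of_mem_target p h.1
  have h0 := L.nondegenerate _ h.2 (fromCoord p z u).snd fun w => by
    have h2 : (fromCoord p z ((trivializationAt E (TangentSpace 𝓘(ℝ, E)) p).continuousLinearMapAt ℝ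
        ((extChartAt 𝓘(ℝ, E) p).symm z) w)).snd = w :=
      (trivializationAt E (TangentSpace 𝓘(ℝ, E)) p).symmL_continuousLinearMapAt (R := ℝ) hb w
    have h3 := hu ((trivializationAt E (TangentSpace 𝓘(ℝ, E)) p).continuousLinearMapAt ℝ
        ((extChartAt 𝓘(ℝ, E) p).symm z) w)
    exact (congrArg (fundamentalTensor L.toFun (fromCoord p z y) (fromCoord p z u).snd)
      h2).symm.trans h3
  have h1 := (trivializationAt E (TangentSpace 𝓘(ℝ, E)) p).continuousLinearMapAt_symmL (R := ℝ) hb u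
  rw [← h1]
  exact (congrArg ((trivializationAt E (TangentSpace 𝓘(ℝ, E)) p).continuousLinearMapAt ℝ
    ((extChartAt 𝓘(ℝ, E) p).symm z)) h0).trans (map_zero _)

theorem PseudoFinslerMetric.euler₃ (L : PseudoFinslerMetric E M) (p : M) {z y : E}
    (h : (z, y) ∈ L.coordDomain p) (u w : E) :
    fderiv ℝ (fderiv ℝ (fderiv ℝ (L.coordFun p))) (z, y) (0, y) (0, u) (0, w) = 0 := by
  set F := L.coordFun p with hF
  have hU := L.isOpen_coordDomain p
  have hF0 : ContDiffOn ℝ ∞ F (L.coordDomain p) := L.contDiffOn_coordFun p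
  have hF1 := contDiffOn_fderiv_infty hU hF0
  have hF2 := contDiffOn_fderiv_infty hU hF1
  have e1 : ∀ q ∈ L.coordDomain p, fderiv ℝ F q (0, q.2) = 2 * F q := by
    intro q hq
    rw [← deriv_line hU hF0 hq]
    have : (fun t : ℝ => F (q + t • ((0 : E), q.2))) =ᶠ[𝓝 0] fun t => (1 + t) ^ 2 * F q := by
      filter_upwards [lt_mem_nhds (show (-1 : ℝ) < 0 by norm_num)] with t ht
      have := L.homogeneous _ hq.2 (1 + t) (by linarith)
      have hq' : q + t • ((0 : E), q.2) = (q.1, (1 + t) • q.2) := by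
        ext <;> simp [add_smul]
      simp only [hq', hF, PseudoFinslerMetric.coordFun]
      rw [← this]
      exact congrArg (fun v => L.toFun ⟨(extChartAt 𝓘(ℝ, E) p).symm q.1, v⟩)
        (map_smul ((trivializationAt E (TangentSpace 𝓘(ℝ, E)) p).symmL ℝ
          ((extChartAt 𝓘(ℝ, E) p).symm q.1)) (1 + t) q.2)
    rw [this.deriv_eq]
    have hd : HasDerivAt (fun t : ℝ => (1 + t) ^ 2 * F q)
        (((2 : ℕ) * (1 + (0 : ℝ)) ^ (2 - 1) * 1) * F q) 0 :=
      (((hasDerivAt_id (0 : ℝ)).const_add 1).pow 2).mul_const _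
    rw [hd.deriv]; norm_num
  have hv : ∀ q : E × E, HasFDerivAt (fun q : E × E => ((0 : E), q.2))
      ((0 : E × E →L[ℝ] E).prod (ContinuousLinearMap.snd ℝ E E)) q := fun q =>
    (hasFDerivAt_const (0 : E) q).prodMk hasFDerivAt_snd
  have e2 : ∀ q ∈ L.coordDomain p, ∀ v : E,
      fderiv ℝ (fderiv ℝ F) q (0, v) (0, q.2) = fderiv ℝ F q (0, v) := by
    intro q hq v
    have : (fun q : E × E => fderiv ℝ F q (0, q.2)) =ᶠ[𝓝 q] fun q => 2 * F q := by
      filter_upwards [hU.mem_nhds hq] with x hx using e1 x hx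
    have h1 := (differentiableAt_of_mem hU hF1 hq).hasFDerivAt.clm_apply (hv q)
    have h2 := (differentiableAt_of_mem hU hF0 hq).hasFDerivAt.const_mul 2
    have := congrArg (fun T : E × E →L[ℝ] ℝ => T (0, v)) ((h1.congr_of_eventuallyEq this.symm).unique h2)
    simp at this
    linarith
  have e3 : fderiv ℝ (fderiv ℝ (fderiv ℝ F)) (z, y) (0, w) (0, u) (0, y) = 0 := by
    have : (fun q : E × E => fderiv ℝ (fderiv ℝ F) q (0, u) (0, q.2)) =ᶠ[𝓝 (z, y)]
        fun q => fderiv ℝ F q (0, u) := by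
      filter_upwards [hU.mem_nhds h] with x hx using e2 x hx u
    have h1 := ((differentiableAt_of_mem hU hF2 h).hasFDerivAt.clm_apply
      (hasFDerivAt_const ((0 : E), u) (z, y))).clm_apply (hv (z, y))
    have h2 := (differentiableAt_of_mem hU hF1 h).hasFDerivAt.clm_apply
      (hasFDerivAt_const ((0 : E), u) (z, y))
    have := congrArg (fun T : E × E →L[ℝ] ℝ => T (0, w)) ((h1.congr_of_eventuallyEq this.symm).unique h2)
    simp at this
    have hs := fderiv₂_symm hU hF0 h (0, u) (0, w)
    linarith
  rw [fderiv₃_symm₂₃ hU hF0 h, fderiv₃_symm₁₂ hU hF0 h, fderiv₃_symm₂₃ hU hF0 h]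
  exact e3

/-- At every tangent vector in the domain of the metric, the Christoffel symbols of the Chern
connection exist and are unique. -/
theorem PseudoFinslerMetric.existsUnique_isChernChristoffel [FiniteDimensional ℝ E]
    (L : PseudoFinslerMetric E M) (p : M) {z y : E} (h : (z, y) ∈ L.coordDomain p) :
    ∃! Γ : E →ₗ[ℝ] E →ₗ[ℝ] E, L.IsChernChristoffel p z y Γ := by
  set F := L.coordFun p with hF
  have hU := L.isOpen_coordDomain p
  have hF0 : ContDiffOn ℝ ∞ F (L.coordDomain p) := L.contDiffOn_coordFun p
  have hF1 := contDiffOn_fderiv_infty hU hF0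
  have hF2 := contDiffOn_fderiv_infty hU hF1
  let F₃ := fderiv ℝ (fderiv ℝ (fderiv ℝ F)) (z, y)
  let F₂ := fderiv ℝ (fderiv ℝ F) (z, y)
  let g := bilinOf F₂ (LinearMap.inr ℝ E E)
  let C := trilinOf F₃ (LinearMap.inr ℝ E E) (LinearMap.inr ℝ E E) (1 / 4)
  let T := trilinOf F₃ (LinearMap.inr ℝ E E) (LinearMap.inl ℝ E E) (1 / 2)
  have hg : ∀ u w, L.gCoord p z y u w = g u w := fun u w => L.gCoord_eq p h u w
  have hC : ∀ a b c, L.cartanCoord p z y a b c = C a b c := fun a b c => by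
    rw [L.cartanCoord_eq p h, fderiv₃_symm₂₃ hU hF0 h, fderiv₃_symm₁₂ hU hF0 h,
      fderiv₃_symm₂₃ hU hF0 h]
    exact (trilinOf_apply F₃ (LinearMap.inr ℝ E E) (LinearMap.inr ℝ E E) (1 / 4) a b c).symm
  have hT : ∀ a b c, T a b c = 1 / 2 * F₃ (a, 0) (0, b) (0, c) := fun a b c =>
    trilinOf_apply F₃ (LinearMap.inr ℝ E E) (LinearMap.inl ℝ E E) (1 / 2) a b c
  have hC' : ∀ a b c, C a b c = 1 / 4 * F₃ (0, a) (0, b) (0, c) := fun a b c =>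
    trilinOf_apply F₃ (LinearMap.inr ℝ E E) (LinearMap.inr ℝ E E) (1 / 4) a b c
  have hg' : ∀ u w, g u w = 1 / 2 * F₂ (0, u) (0, w) := fun u w => rfl
  have main := existsUnique_chern_algebra g C T y
    (fun u w => by rw [hg', hg', fderiv₂_symm hU hF0 h])
    (fun u hu => L.gCoord_nondegenerate p h fun w => by rw [hg]; exact hu w)
    (fun a b c => by rw [hC', hC', fderiv₃_symm₁₂ hU hF0 h])
    (fun a b c => by rw [hC', hC', fderiv₃_symm₂₃ hU hF0 h])
    (fun a b c => by rw [hT, hT, fderiv₃_symm₂₃ hU hF0 h])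
    (fun b c => by rw [hC', L.euler₃ p h b c, mul_zero])
  clear_value g C T
  -- the derivative of `g_V(Y, Z)`
  have hder : ∀ V Y Z : E → E, ContDiffAt ℝ ∞ V z → ContDiffAt ℝ ∞ Y z → ContDiffAt ℝ ∞ Z z →
      V z = y → ∀ ξ : E, fderiv ℝ (fun x => L.gCoord p x (V x) (Y x) (Z x)) z ξ =
        T ξ (Y z) (Z z) + 2 * C (fderiv ℝ V z ξ) (Y z) (Z z) + g (fderiv ℝ Y z ξ) (Z z)
          + g (Y z) (fderiv ℝ Z z ξ) := by
    intro V Y Z hV hY hZ hVz ξ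
    have dV := (hV.differentiableAt (by simp)).hasFDerivAt
    have dY := (hY.differentiableAt (by simp)).hasFDerivAt
    have dZ := (hZ.differentiableAt (by simp)).hasFDerivAt
    have hgr : HasFDerivAt (fun x => (x, V x)) ((ContinuousLinearMap.id ℝ E).prod (fderiv ℝ V z)) z :=
      (hasFDerivAt_id z).prodMk dV
    have hev : (fun x => L.gCoord p x (V x) (Y x) (Z x)) =ᶠ[𝓝 z]
        fun x => 1 / 2 * fderiv ℝ (fderiv ℝ F) (x, V x) (0, Y x) (0, Z x) := by
      have : ∀ᶠ x in 𝓝 z, (x, V x) ∈ L.coordDomain p :=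
        hgr.continuousAt (hU.mem_nhds (by rw [hVz]; exact h))
      filter_upwards [this] with x hx using L.gCoord_eq p hx _ _
    rw [hev.fderiv_eq, fderiv_half_bilin hU hF0 hgr ((hasFDerivAt_const (0 : E) z).prodMk dY)
      ((hasFDerivAt_const (0 : E) z).prodMk dZ) (by rw [hVz]; exact h) ξ]
    have hsplit : F₃ (ξ, fderiv ℝ V z ξ) (0, Y z) (0, Z z) =
        F₃ (ξ, 0) (0, Y z) (0, Z z) + F₃ (0, fderiv ℝ V z ξ) (0, Y z) (0, Z z) := by
      rw [← trilin_add, Prod.mk_add_mk, add_zero, zero_add]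
    rw [hT, hC', hg', hg', hVz]
    change (1 / 2 : ℝ) * (F₂ (0, Y z) (0, fderiv ℝ Z z ξ) + (F₂ (0, fderiv ℝ Y z ξ) (0, Z z)
      + F₃ (ξ, fderiv ℝ V z ξ) (0, Y z) (0, Z z))) = _
    rw [hsplit]
    ring
  have hiff : ∀ Γ : E →ₗ[ℝ] E →ₗ[ℝ] E, L.IsChernChristoffel p z y Γ ↔ ((∀ a b, Γ a b = Γ b a) ∧
      ∀ a b c, T a b c = g (Γ a b) c + g b (Γ a c) + 2 * C (Γ a y) b c) := by
    intro Γ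
    constructor
    · rintro ⟨h1, h2⟩
      refine ⟨fun a b => ?_, fun a b c => ?_⟩
      · have := h1 (fun _ => a) (fun _ => b) contDiffAt_const contDiffAt_const
        simpa [nablaCoord, VectorField.lieBracket, sub_eq_zero] using this
      · have := h2 (fun _ => y) (fun _ => a) (fun _ => b) (fun _ => c) contDiffAt_const
          contDiffAt_const contDiffAt_const contDiffAt_const rfl
        rw [hder _ _ _ contDiffAt_const contDiffAt_const contDiffAt_const rfl] at this
        simpa [nablaCoord, hg, hC] using this
    · rintro ⟨h1, h2⟩
      refine ⟨fun X Y _ _ => ?_, fun V X Y Z hV hX hY hZ hVz => ?_⟩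
      · rw [nablaCoord, nablaCoord, VectorField.lieBracket, h1 (X z) (Y z)]
        abel
      · rw [hder V Y Z hV hY hZ hVz, h2 (X z) (Y z) (Z z)]
        simp only [nablaCoord, hg, hC, hVz, map_add, LinearMap.add_apply]
        ring
  obtain ⟨Γ, hΓ, hu⟩ := main
  exact ⟨Γ, (hiff Γ).2 hΓ, fun Γ' h' => hu Γ' ((hiff Γ').1 h')⟩

end Existence

section Curves

variable {E : Type*} [NormedAddCommGroup E] [NormedSpace ℝ E]
  {M : Type*} [TopologicalSpace M] [ChartedSpace E M] [IsManifold 𝓘(ℝ, E) ∞ M]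

/-- The Christoffel symbols of the Chern connection in the preferred chart at `p`, at the tangent
vector with coordinates `(z, y)`. On the domain of the metric they are characterized by the
axioms of the Chern connection (`existsUnique_isChernChristoffel`). -/
def PseudoFinslerMetric.christoffel (L : PseudoFinslerMetric E M) (p : M) (z y : E) :
    E →ₗ[ℝ] E →ₗ[ℝ] E :=
  Classical.epsilon (L.IsChernChristoffel p z y)

theorem PseudoFinslerMetric.isChernChristoffel_christoffel [FiniteDimensional ℝ E]
    (L : PseudoFinslerMetric E M) (p : M) {z y : E} (h : (z, y) ∈ L.coordDomain p) :
    L.IsChernChristoffel p z y (L.christoffel p z y) :=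
  Classical.epsilon_spec (L.existsUnique_isChernChristoffel p h).exists

/-- The velocity at time `t` of a curve, regarded as a curve on the interval `s` only
(so that it is one-sided at the endpoints of `s`). -/
def velocity (γ : ℝ → M) (s : Set ℝ) (t : ℝ) : TangentSpace 𝓘(ℝ, E) (γ t) :=
  mfderivWithin 𝓘(ℝ, ℝ) 𝓘(ℝ, E) γ s t (1 : ℝ)

/-- The velocity as an element of the tangent bundle. -/
def velocityLift (γ : ℝ → M) (s : Set ℝ) (t : ℝ) : TangentBundle 𝓘(ℝ, E) M :=
  ⟨γ t, velocity γ s t⟩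

/-- The covariant derivative `D^W_γ X` at time `t` along the curve `γ : s → M`, with reference
vector field `W` along `γ`: in coordinates `Ẋᵏ + Xⁱ γ̇ʲ Γᵏᵢⱼ(W)`. The preferred chart at the point
`γ t` is used. -/
def PseudoFinslerMetric.covDeriv (L : PseudoFinslerMetric E M) (γ : ℝ → M) (s : Set ℝ)
    (W X : ∀ t : ℝ, TangentSpace 𝓘(ℝ, E) (γ t)) (t : ℝ) : TangentSpace 𝓘(ℝ, E) (γ t) :=
  (trivializationAt E (TangentSpace 𝓘(ℝ, E)) (γ t)).symmL ℝ (γ t)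
    (derivWithin (fun r => toCoord (γ t) ⟨γ r, X r⟩) s t
      + L.christoffel (γ t) (extChartAt 𝓘(ℝ, E) (γ t) (γ t)) (toCoord (γ t) ⟨γ t, W t⟩)
          (toCoord (γ t) ⟨γ t, X t⟩) (toCoord (γ t) (velocityLift γ s t)))

/-- `γ`, restricted to the interval `[a, b]`, is a geodesic: a smooth `L`-admissible curve whose
velocity is parallel, `D^γ̇_γ γ̇ = 0`. -/
structure PseudoFinslerMetric.IsGeodesicOn (L : PseudoFinslerMetric E M) (γ : ℝ → M) (a b : ℝ) :
    Prop where
  smooth : ContMDiffOn 𝓘(ℝ, ℝ) 𝓘(ℝ, E) ∞ γ (Icc a b)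
  admissible : ∀ t ∈ Icc a b, velocityLift γ (Icc a b) t ∈ L.domain
  parallel : ∀ t ∈ Icc a b,
    L.covDeriv γ (Icc a b) (velocity γ (Icc a b)) (velocity γ (Icc a b)) t = 0

/-- A subdivision `a = t₀ < t₁ < ⋯ < t_h < t_{h+1} = b`. -/
structure Subdivision (a b : ℝ) (h : ℕ) where
  /-- the points of the subdivision -/
  pt : Fin (h + 2) → ℝ
  strictMono : StrictMono pt
  first : pt 0 = a
  last : pt (Fin.last (h + 1)) = b

/-- The `i`-th closed piece `[t_i, t_{i+1}]` of a subdivision. -/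
def Subdivision.piece {a b : ℝ} {h : ℕ} (τ : Subdivision a b h) (i : Fin (h + 1)) : Set ℝ :=
  Icc (τ.pt i.castSucc) (τ.pt i.succ)

/-- The `L`-admissible piecewise smooth curves on `[a, b]` whose breaks are among the interior
points of `τ` (both velocities at a break being in the domain of `L`). Only the restriction of `γ`
to `[a, b]` matters. Continuity is implied, as consecutive closed pieces overlap. -/
structure PseudoFinslerMetric.IsAdmissibleCurve (L : PseudoFinslerMetric E M) {a b : ℝ} {h : ℕ}
    (τ : Subdivision a b h) (γ : ℝ → M) : Prop where
  smooth : ∀ i, ContMDiffOn 𝓘(ℝ, ℝ) 𝓘(ℝ, E) ∞ γ (τ.piece i)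
  admissible : ∀ i, ∀ t ∈ τ.piece i, velocityLift γ (τ.piece i) t ∈ L.domain

/-- The continuous, piecewise smooth vector fields along `γ` with the breaks of `τ`. -/
def IsPiecewiseSmoothField {a b : ℝ} {h : ℕ} (τ : Subdivision a b h) (γ : ℝ → M)
    (W : ∀ t : ℝ, TangentSpace 𝓘(ℝ, E) (γ t)) : Prop :=
  ∀ i, ContMDiffOn 𝓘(ℝ, ℝ) 𝓘(ℝ, E).tangent ∞
    (fun t => (⟨γ t, W t⟩ : TangentBundle 𝓘(ℝ, E) M)) (τ.piece i)

/-- The tangent space at `p` of a subset `P` of `M` that carries a manifold structure: the image of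
the differential of the inclusion. -/
def tangentSpaceOf {EP : Type*} [NormedAddCommGroup EP] [NormedSpace ℝ EP] (P : Set M)
    [ChartedSpace EP P] (p : M) : Set (TangentSpace 𝓘(ℝ, E) p) :=
  {w | ∃ hp : p ∈ P, ∃ u : TangentSpace 𝓘(ℝ, EP) (⟨p, hp⟩ : P),
    mfderiv 𝓘(ℝ, EP) 𝓘(ℝ, E) (Subtype.val : P → M) ⟨p, hp⟩ u = w}

/-- The differential of the energy functional `E(γ) = (1/2) ∫ L(γ̇)` at `γ`, given by the right-hand
side of the first variation formula:
`dE_γ(W) = - ∫ g_γ̇(W, D^γ̇_γ γ̇) dt + g_γ̇(W, γ̇)|ₐᵇ - ∑ᵢ (ℒ(γ̇(tᵢ⁺))(W) - ℒ(γ̇(tᵢ⁻))(W))`,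
the integral being taken piece by piece. -/
def PseudoFinslerMetric.dE (L : PseudoFinslerMetric E M) {a b : ℝ} {h : ℕ} (τ : Subdivision a b h)
    (γ : ℝ → M) (W : ∀ t : ℝ, TangentSpace 𝓘(ℝ, E) (γ t)) : ℝ :=
  -(∑ i : Fin (h + 1), ∫ t in (τ.pt i.castSucc)..(τ.pt i.succ),
      L.g (velocityLift γ (τ.piece i) t) (W t)
        (L.covDeriv γ (τ.piece i) (velocity γ (τ.piece i)) (velocity γ (τ.piece i)) t))
  + (L.g (velocityLift γ (τ.piece (Fin.last h)) b) (W b) (velocity γ (τ.piece (Fin.last h)) b)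
      - L.g (velocityLift γ (τ.piece 0) a) (W a) (velocity γ (τ.piece 0) a))
  - ∑ i : Fin h,
      ((L.legendre (velocityLift γ (τ.piece i.succ) (τ.pt i.succ.castSucc))).2
          (W (τ.pt i.succ.castSucc))
        - (L.legendre (velocityLift γ (τ.piece i.castSucc) (τ.pt i.succ.castSucc))).2
          (W (τ.pt i.succ.castSucc)))

/-- The curves of `C_L(P, Q)`: `L`-admissible piecewise smooth curves from `P` to `Q`. -/
structure PseudoFinslerMetric.IsCurveJoining (L : PseudoFinslerMetric E M) {a b : ℝ} {h : ℕ}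
    (τ : Subdivision a b h) (P Q : Set M) (γ : ℝ → M) : Prop
    extends L.IsAdmissibleCurve τ γ where
  left_mem : γ a ∈ P
  right_mem : γ b ∈ Q

/-- `γ` is a critical point of the energy restricted to `C_L(P, Q)`: `dE_γ(W) = 0` for every
`W ∈ T_γ C_L(P, Q)`, that is, for every continuous piecewise smooth vector field `W` along `γ`, with
the same breaks, tangent to `P` and to `Q` at the endpoints. -/
def PseudoFinslerMetric.IsCriticalPoint (L : PseudoFinslerMetric E M) {a b : ℝ} {h : ℕ}
    (τ : Subdivision a b h)
    {EP : Type*} [NormedAddCommGroup EP] [NormedSpace ℝ EP] (P : Set M) [ChartedSpace EP P]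
    {EQ : Type*} [NormedAddCommGroup EQ] [NormedSpace ℝ EQ] (Q : Set M) [ChartedSpace EQ Q]
    (γ : ℝ → M) : Prop :=
  ∀ W : ∀ t : ℝ, TangentSpace 𝓘(ℝ, E) (γ t), IsPiecewiseSmoothField τ γ W →
    W a ∈ tangentSpaceOf (EP := EP) P (γ a) → W b ∈ tangentSpaceOf (EP := EQ) Q (γ b) →
    L.dE τ γ W = 0

end Curves

end

end PseudoFinsler

/-! Let F be L read in a chart, as a function of position z and velocity y, and let EL(w) = d/dt ∂_y
F(w) - ∂_z F(w) along γ. The bridge between the Chern connection and the calculus of variations is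
the identity g_γ̇(w, D γ̇) = ½ EL(w). It follows from the two axioms of the connection and Euler's
relations for a 2-homogeneous F (`gCoord_christoffel`). As `covDeriv` at t is computed in the chart
centred at γ t, which moves with t, covariance of EL under chart changes (`eulerLagrange_comp`,
`curveEL_change`) is needed to work in one fixed chart (`g_covDeriv`).

A critical curve is tested against three kinds of fields. Fields supported inside one piece give EL
= 0 there by the fundamental lemma of the calculus of variations, and nondegeneracy of g turns this
into D γ̇ = 0 on the closed piece (`IsCriticalPoint.parallel`). The integral then drops out of dE,
and a field living at a single break shows that the two one-sided velocities have the same Legendre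
transform; injectivity makes them equal (`IsCriticalPoint.velocityLift_eq`). Finally, fields living
at one endpoint give the orthogonality conditions.

Smoothness across a break uses nondegeneracy once more: the vertical Hessian of F is invertible, so
EL = 0 can be solved for the acceleration and becomes a smooth first-order system for (z, y). The
phase curves on both sides of the break agree at the break and solve the same system, so the glued
curve is differentiable with derivative a smooth function of itself, and bootstrapping makes it
smooth (`contMDiffAt_of_parallel`). Uniqueness for ordinary differential equations is not needed.

Conversely, along a geodesic the integral vanishes and the break terms cancel, so that dE consists
of two endpoint terms only (`dE_of_isGeodesicOn`), and orthogonality kills both. -/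

namespace PseudoFinsler

noncomputable section

/-! ### Euler-Lagrange expressions of Lagrangians on a vector space. -/

section EulerLagrange

variable {E : Type*} [NormedAddCommGroup E] [NormedSpace ℝ E]

/-- The Euler-Lagrange expression `d/dt ∂_y F(w) - ∂_z F(w)` of a Lagrangian `F` along a curve with
position and velocity `q` and acceleration `a`, evaluated on the vector `w`. -/
def eulerLagrange (F : E × E → ℝ) (q : E × E) (a w : E) : ℝ :=
  fderiv ℝ (fderiv ℝ F) q (q.2, a) (0, w) - fderiv ℝ F q (w, 0)

theorem eulerLagrange_smul (F : E × E → ℝ) (q : E × E) (a w : E) (c : ℝ) :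
    eulerLagrange F q a (c • w) = c * eulerLagrange F q a w := by
  have h1 : ((0 : E), c • w) = c • ((0 : E), w) := by simp
  have h2 : (c • w, (0 : E)) = c • (w, (0 : E)) := by simp
  rw [eulerLagrange, eulerLagrange, h1, h2, map_smul, map_smul, smul_eq_mul, smul_eq_mul]
  ring

/-- The Euler-Lagrange expression is invariant under changes of coordinates. -/
theorem eulerLagrange_comp {F G : E × E → ℝ} {U : Set (E × E)} {O : Set E} {φ : E → E}
    (hU : IsOpen U) (hG : ContDiffOn ℝ ∞ G U) (hO : IsOpen O) (hφ : ContDiffOn ℝ ∞ φ O)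
    {q : E × E} (hq : q.1 ∈ O) (hqU : (φ q.1, fderiv ℝ φ q.1 q.2) ∈ U)
    (hF : F =ᶠ[𝓝 q] fun q => G (φ q.1, fderiv ℝ φ q.1 q.2)) (a w : E) :
    eulerLagrange F q a w = eulerLagrange G (φ q.1, fderiv ℝ φ q.1 q.2)
      (fderiv ℝ φ q.1 a + fderiv ℝ (fderiv ℝ φ) q.1 q.2 q.2) (fderiv ℝ φ q.1 w) := by
  have hφ1 := contDiffOn_fderiv_infty hO hφ
  have hG1 := contDiffOn_fderiv_infty hU hG
  have dφ : ∀ x : E × E, x.1 ∈ O → HasFDerivAt (fun x : E × E => φ x.1)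
      ((fderiv ℝ φ x.1).comp (ContinuousLinearMap.fst ℝ E E)) x := fun x hx =>
    HasFDerivAt.comp x (hasFDerivAt_of_mem hO hφ hx) hasFDerivAt_fst
  have dφ1 : ∀ x : E × E, x.1 ∈ O → HasFDerivAt (fun x : E × E => fderiv ℝ φ x.1)
      ((fderiv ℝ (fderiv ℝ φ) x.1).comp (ContinuousLinearMap.fst ℝ E E)) x := fun x hx =>
    HasFDerivAt.comp x (hasFDerivAt_of_mem hO hφ1 hx) hasFDerivAt_fst
  -- The tangent lift (z, y) ↦ (φ z, Dφ(z) y) of φ; its z-derivative brings in D²φ.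
  have dΨ : ∀ x : E × E, x.1 ∈ O → HasFDerivAt (fun x : E × E => (φ x.1, fderiv ℝ φ x.1 x.2)) _ x :=
    fun x hx => (dφ x hx).prodMk ((dφ1 x hx).clm_apply hasFDerivAt_snd)
  have hev : ∀ᶠ x in 𝓝 q, x.1 ∈ O ∧ (φ x.1, fderiv ℝ φ x.1 x.2) ∈ U ∧
      F =ᶠ[𝓝 x] fun q => G (φ q.1, fderiv ℝ φ q.1 q.2) := by
    refine (continuousAt_fst.eventually (hO.mem_nhds hq)).and
      (((dΨ q hq).continuousAt.eventually (hU.mem_nhds hqU)).and hF.eventually_nhds)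
  have h1 : ∀ᶠ x in 𝓝 q, ∀ u v : E, fderiv ℝ F x (u, v) =
      fderiv ℝ G (φ x.1, fderiv ℝ φ x.1 x.2)
        (fderiv ℝ φ x.1 u, fderiv ℝ φ x.1 v + fderiv ℝ (fderiv ℝ φ) x.1 u x.2) := by
    filter_upwards [hev] with x ⟨hx, hxU, hxF⟩ u v
    have := ((hasFDerivAt_of_mem hU hG hxU).comp x (dΨ x hx)).congr_of_eventuallyEq hxF
    rw [this.fderiv]
    simp
  have h2 : (fun x => fderiv ℝ F x (0, w)) =ᶠ[𝓝 q] fun x =>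
      fderiv ℝ G (φ x.1, fderiv ℝ φ x.1 x.2) (0, fderiv ℝ φ x.1 w) := by
    filter_upwards [h1] with x hx
    rw [hx]; simp
  have hdF : DifferentiableAt ℝ (fderiv ℝ F) q := by
    have hΨ : ContDiffAt ℝ ∞ (fun x : E × E => (φ x.1, fderiv ℝ φ x.1 x.2)) q := by
      have c0 := hφ.contDiffAt (hO.mem_nhds hq)
      have c1 := hφ1.contDiffAt (hO.mem_nhds hq)
      exact (c0.comp q contDiffAt_fst).prodMk ((c1.comp q contDiffAt_fst).clm_apply contDiffAt_snd)
    have hFc : ContDiffAt ℝ ∞ F q :=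
      (ContDiffAt.comp q (hG.contDiffAt (hU.mem_nhds hqU)) hΨ).congr_of_eventuallyEq hF
    exact (hFc.fderiv_right (m := 1) (by norm_cast)).differentiableAt (by simp)
  have h3 := (hdF.hasFDerivAt.clm_apply (hasFDerivAt_const ((0 : E), w) q)).congr_of_eventuallyEq
    h2.symm
  have h4 := (((hasFDerivAt_of_mem hU hG1 hqU).comp q (dΨ q hq)).clm_apply
    ((hasFDerivAt_const (0 : E) q).prodMk ((dφ1 q hq).clm_apply (hasFDerivAt_const w q))))
  have h5 := congrArg (fun T : E × E →L[ℝ] ℝ => T (q.2, a)) (h3.unique h4)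
  simp at h5
  -- D²φ(y, w) appears in d/dt ∂_y F, where Dφ(z) w is differentiated along the motion, and D²φ(w,
  -- y) appears in ∂_z F. Symmetry makes the two contributions cancel.
  have h6 : fderiv ℝ (fderiv ℝ φ) q.1 q.2 w = fderiv ℝ (fderiv ℝ φ) q.1 w q.2 :=
    ((hφ.contDiffAt (hO.mem_nhds hq)).isSymmSndFDerivAt (by simpa using two_le_infty)) q.2 w
  rw [eulerLagrange, eulerLagrange, h5, h1.self_of_nhds, ← h6]
  have h7 : (fderiv ℝ φ q.1 w, fderiv ℝ φ q.1 0 + fderiv ℝ (fderiv ℝ φ) q.1 q.2 w) =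
      (fderiv ℝ φ q.1 w, (0 : E)) + ((0 : E), fderiv ℝ (fderiv ℝ φ) q.1 q.2 w) := by simp
  rw [h7, map_add]
  ring

/-- The vertical Hessian of a Lagrangian. -/
def verticalHessian (F : E × E → ℝ) (q : E × E) : E →L[ℝ] E →L[ℝ] ℝ :=
  ((ContinuousLinearMap.compL ℝ E (E × E) ℝ).flip (ContinuousLinearMap.inr ℝ E E)).comp
    ((fderiv ℝ (fderiv ℝ F) q).comp (ContinuousLinearMap.inr ℝ E E))

theorem verticalHessian_apply (F : E × E → ℝ) (q : E × E) (u w : E) :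
    verticalHessian F q u w = fderiv ℝ (fderiv ℝ F) q (0, u) (0, w) := by
  simp [verticalHessian]

/-- The force term in the Euler-Lagrange equation. -/
def lagrangeForce (F : E × E → ℝ) (q : E × E) : E →L[ℝ] ℝ :=
  (fderiv ℝ F q).comp (ContinuousLinearMap.inl ℝ E E) -
    (fderiv ℝ (fderiv ℝ F) q (q.2, 0)).comp (ContinuousLinearMap.inr ℝ E E)

/-- The acceleration enters only through the vertical Hessian, so the Euler-Lagrange equation is
affine in it and can be solved when that Hessian is invertible. -/
theorem eulerLagrange_eq (F : E × E → ℝ) (q : E × E) (a w : E) :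
    eulerLagrange F q a w = verticalHessian F q a w - lagrangeForce F q w := by
  have : (q.2, a) = (q.2, (0 : E)) + ((0 : E), a) := by simp
  rw [eulerLagrange, verticalHessian_apply, lagrangeForce, this, map_add]
  simp
  ring

/-- The acceleration prescribed by the Euler-Lagrange equation of a regular Lagrangian. -/
def lagrangeSpray (F : E × E → ℝ) (q : E × E) : E :=
  (verticalHessian F q).inverse (lagrangeForce F q)

variable {F : E × E → ℝ} {U : Set (E × E)}

theorem contDiffOn_verticalHessian (hU : IsOpen U) (hF : ContDiffOn ℝ ∞ F U) :
    ContDiffOn ℝ ∞ (verticalHessian F) U := by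
  have h2 := contDiffOn_fderiv_infty hU (contDiffOn_fderiv_infty hU hF)
  exact contDiffOn_const.clm_comp (h2.clm_comp contDiffOn_const)

theorem contDiffOn_lagrangeForce (hU : IsOpen U) (hF : ContDiffOn ℝ ∞ F U) :
    ContDiffOn ℝ ∞ (lagrangeForce F) U := by
  have h1 := contDiffOn_fderiv_infty hU hF
  have h2 := contDiffOn_fderiv_infty hU h1
  exact (h1.clm_comp contDiffOn_const).sub
    ((h2.clm_apply (contDiffOn_snd.prodMk contDiffOn_const)).clm_comp contDiffOn_const)

/-- Nondegeneracy is injectivity into the dual space, which has the same finite dimension. -/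
theorem isInvertible_verticalHessian [FiniteDimensional ℝ E] {q : E × E}
    (hnd : ∀ u, (∀ w, fderiv ℝ (fderiv ℝ F) q (0, u) (0, w) = 0) → u = 0) :
    (verticalHessian F q).IsInvertible := by
  have hinj : Function.Injective (verticalHessian F q).toLinearMap := by
    rw [← LinearMap.ker_eq_bot, LinearMap.ker_eq_bot']
    intro u hu
    refine hnd u fun w => ?_
    rw [← verticalHessian_apply]
    exact congrArg (fun T : E →L[ℝ] ℝ => T w) hu
  have hdim : Module.finrank ℝ E = Module.finrank ℝ (E →L[ℝ] ℝ) := by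
    rw [← LinearMap.toContinuousLinearMap.finrank_eq]
    exact (Subspace.dual_finrank_eq (K := ℝ) (V := E)).symm
  exact ⟨(LinearEquiv.ofInjectiveOfFinrankEq _ hinj hdim).toContinuousLinearEquiv,
    by ext; rfl⟩

theorem eulerLagrange_eq_zero_iff [FiniteDimensional ℝ E] {q : E × E}
    (hnd : ∀ u, (∀ w, fderiv ℝ (fderiv ℝ F) q (0, u) (0, w) = 0) → u = 0) (a : E) :
    (∀ w, eulerLagrange F q a w = 0) ↔ a = lagrangeSpray F q := by
  obtain ⟨e, he⟩ := isInvertible_verticalHessian hnd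
  have : (∀ w, eulerLagrange F q a w = 0) ↔ e a = lagrangeForce F q := by
    rw [ContinuousLinearMap.ext_iff]
    refine forall_congr' fun w => ?_
    rw [eulerLagrange_eq, ← he, sub_eq_zero]
    rfl
  rw [this, lagrangeSpray, ← he, ContinuousLinearMap.inverse_equiv]
  exact (e.eq_symm_apply).symm

/-- Inversion of operators is smooth near an invertible one; the default value of `inverse` at
singular operators is never met on `U`. -/
theorem contDiffOn_lagrangeSpray [FiniteDimensional ℝ E] (hU : IsOpen U)
    (hF : ContDiffOn ℝ ∞ F U)
    (hnd : ∀ q ∈ U, ∀ u, (∀ w, fderiv ℝ (fderiv ℝ F) q (0, u) (0, w) = 0) → u = 0) :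
    ContDiffOn ℝ ∞ (lagrangeSpray F) U := by
  intro q hq
  obtain ⟨e, he⟩ := isInvertible_verticalHessian (hnd q hq)
  have h1 : ContDiffAt ℝ ∞ ContinuousLinearMap.inverse (verticalHessian F q) := by
    rw [← he]; exact contDiffAt_map_inverse e
  exact (h1.comp_contDiffWithinAt q (contDiffOn_verticalHessian hU hF q hq)).clm_apply
    (contDiffOn_lagrangeForce hU hF q hq)

end EulerLagrange

/-! ### Homogeneity relations and the spray of the Chern connection. -/

section Spray

variable {E : Type*} [NormedAddCommGroup E] [NormedSpace ℝ E]
  {M : Type*} [TopologicalSpace M] [ChartedSpace E M] [IsManifold 𝓘(ℝ, E) ∞ M]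
  (L : PseudoFinslerMetric E M) (p : M)

/-- Euler's theorem in degree two: differentiate F(z, (1 + t) y) = (1 + t)² F(z, y) at t = 0. -/
theorem PseudoFinslerMetric.euler₁ {q : E × E} (hq : q ∈ L.coordDomain p) :
    fderiv ℝ (L.coordFun p) q (0, q.2) = 2 * L.coordFun p q := by
  rw [← deriv_line (L.isOpen_coordDomain p) (L.contDiffOn_coordFun p) hq]
  have : (fun t : ℝ => L.coordFun p (q + t • ((0 : E), q.2))) =ᶠ[𝓝 0]
      fun t => (1 + t) ^ 2 * L.coordFun p q := by
    -- Homogeneity is available for positive factors only, hence the restriction t > -1.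
    filter_upwards [lt_mem_nhds (show (-1 : ℝ) < 0 by norm_num)] with t ht
    have := L.homogeneous _ hq.2 (1 + t) (by linarith)
    have hq' : q + t • ((0 : E), q.2) = (q.1, (1 + t) • q.2) := by
      ext <;> simp [add_smul]
    simp only [hq', PseudoFinslerMetric.coordFun]
    rw [← this]
    exact congrArg (fun v => L.toFun ⟨(extChartAt 𝓘(ℝ, E) p).symm q.1, v⟩)
      (map_smul ((trivializationAt E (TangentSpace 𝓘(ℝ, E)) p).symmL ℝ
        ((extChartAt 𝓘(ℝ, E) p).symm q.1)) (1 + t) q.2)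
  rw [this.deriv_eq]
  have hd : HasDerivAt (fun t : ℝ => (1 + t) ^ 2 * L.coordFun p q)
      (((2 : ℕ) * (1 + (0 : ℝ)) ^ (2 - 1) * 1) * L.coordFun p q) 0 :=
    (((hasDerivAt_id (0 : ℝ)).const_add 1).pow 2).mul_const _
  rw [hd.deriv]; norm_num

/-- The derivative of `euler₁` in the direction (u, v); the second summand arises because the vector
(0, y) varies with the point. -/
theorem PseudoFinslerMetric.euler₂ {q : E × E} (hq : q ∈ L.coordDomain p) (u v : E) :
    fderiv ℝ (fderiv ℝ (L.coordFun p)) q (u, v) (0, q.2) + fderiv ℝ (L.coordFun p) q (0, v)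
      = 2 * fderiv ℝ (L.coordFun p) q (u, v) := by
  have hU := L.isOpen_coordDomain p
  have hF0 := L.contDiffOn_coordFun p
  have : (fun q : E × E => fderiv ℝ (L.coordFun p) q (0, q.2)) =ᶠ[𝓝 q]
      fun q => 2 * L.coordFun p q := by
    filter_upwards [hU.mem_nhds hq] with x hx using L.euler₁ p hx
  have h1 := (hasFDerivAt_of_mem hU (contDiffOn_fderiv_infty hU hF0) hq).clm_apply
    ((hasFDerivAt_const (0 : E) q).prodMk hasFDerivAt_snd)
  have h2 := (hasFDerivAt_of_mem hU hF0 hq).const_mul 2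
  have := congrArg (fun T : E × E →L[ℝ] ℝ => T (u, v))
    ((h1.congr_of_eventuallyEq this.symm).unique h2)
  simp at this
  linarith

/-- The purely vertical case of `euler₂` reads D²F(0, w)(0, y) = DF(0, w); differentiate it in the
position variable. -/
theorem PseudoFinslerMetric.euler₃_horizontal {q : E × E} (hq : q ∈ L.coordDomain p) (u w : E) :
    fderiv ℝ (fderiv ℝ (fderiv ℝ (L.coordFun p))) q (u, 0) (0, q.2) (0, w)
      = fderiv ℝ (fderiv ℝ (L.coordFun p)) q (u, 0) (0, w) := by
  have hU := L.isOpen_coordDomain p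
  have hF0 := L.contDiffOn_coordFun p
  have hF1 := contDiffOn_fderiv_infty hU hF0
  rw [fderiv₃_symm₂₃ hU hF0 hq]
  have : (fun q : E × E => fderiv ℝ (fderiv ℝ (L.coordFun p)) q (0, w) (0, q.2)) =ᶠ[𝓝 q]
      fun q => fderiv ℝ (L.coordFun p) q (0, w) := by
    filter_upwards [hU.mem_nhds hq] with x hx
    linarith [L.euler₂ p hx 0 w]
  have h1 := ((hasFDerivAt_of_mem hU (contDiffOn_fderiv_infty hU hF1) hq).clm_apply
    (hasFDerivAt_const ((0 : E), w) q)).clm_apply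
      ((hasFDerivAt_const (0 : E) q).prodMk hasFDerivAt_snd)
  have h2 := (hasFDerivAt_of_mem hU hF1 hq).clm_apply (hasFDerivAt_const ((0 : E), w) q)
  have := congrArg (fun T : E × E →L[ℝ] ℝ => T (u, 0))
    ((h1.congr_of_eventuallyEq this.symm).unique h2)
  have h00 : ((0 : E), (0 : E)) = 0 := rfl
  simpa [h00] using this

theorem PseudoFinslerMetric.fderiv_gCoord {z y : E} (h : (z, y) ∈ L.coordDomain p) (a b c : E) :
    fderiv ℝ (fun x => L.gCoord p x y b c) z a =
      1 / 2 * fderiv ℝ (fderiv ℝ (fderiv ℝ (L.coordFun p))) (z, y) (a, 0) (0, b) (0, c) := by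
  have hU := L.isOpen_coordDomain p
  have hgr : HasFDerivAt (fun x : E => (x, y)) ((ContinuousLinearMap.id ℝ E).prod 0) z :=
    (hasFDerivAt_id z).prodMk (hasFDerivAt_const y z)
  have hev : (fun x => L.gCoord p x y b c) =ᶠ[𝓝 z]
      fun x => 1 / 2 * fderiv ℝ (fderiv ℝ (L.coordFun p)) (x, y) (0, b) (0, c) := by
    filter_upwards [hgr.continuousAt (hU.mem_nhds h)] with x hx using L.gCoord_eq p hx _ _
  rw [hev.fderiv_eq, fderiv_half_bilin hU (L.contDiffOn_coordFun p) hgr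
    (hasFDerivAt_const ((0 : E), b) z) (hasFDerivAt_const ((0 : E), c) z) h a]
  simp

/-- The vertical Hessian is homogeneous of degree zero, hence constant along the ray through y. -/
theorem PseudoFinslerMetric.cartanCoord_self {z y : E} (h : (z, y) ∈ L.coordDomain p) (a c : E) :
    L.cartanCoord p z y a y c = 0 := by
  have hU := L.isOpen_coordDomain p
  have hF0 := L.contDiffOn_coordFun p
  rw [L.cartanCoord_eq p h, fderiv₃_symm₁₂ hU hF0 h, L.euler₃ p h, mul_zero]

/-- The covariant derivative of the velocity is the Euler-Lagrange expression. -/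
theorem PseudoFinslerMetric.gCoord_christoffel [FiniteDimensional ℝ E] {z y : E}
    (h : (z, y) ∈ L.coordDomain p) (a w : E) :
    L.gCoord p z y w (a + L.christoffel p z y y y) =
      1 / 2 * eulerLagrange (L.coordFun p) (z, y) a w := by
  have hU := L.isOpen_coordDomain p
  have hF0 := L.contDiffOn_coordFun p
  obtain ⟨h1, h2⟩ := L.isChernChristoffel_christoffel p h
  set Γ := L.christoffel p z y
  have hsymm : ∀ a b, Γ a b = Γ b a := fun a b => by
    have := h1 (fun _ => a) (fun _ => b) contDiffAt_const contDiffAt_const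
    simpa [nablaCoord, VectorField.lieBracket, sub_eq_zero] using this
  have hcomp : ∀ a b c, 1 / 2 * fderiv ℝ (fderiv ℝ (fderiv ℝ (L.coordFun p))) (z, y)
      (a, 0) (0, b) (0, c) = L.gCoord p z y (Γ a b) c + L.gCoord p z y b (Γ a c)
        + 2 * L.cartanCoord p z y (Γ a y) b c := fun a b c => by
    have := h2 (fun _ => y) (fun _ => a) (fun _ => b) (fun _ => c) contDiffAt_const
      contDiffAt_const contDiffAt_const contDiffAt_const rfl
    rw [L.fderiv_gCoord p h] at this
    simpa [nablaCoord] using this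
  -- In both instances y is an argument of the Cartan tensor, so that term vanishes. The first gives
  -- ½ D²F(y, 0)(0, w) = g(Γ(y, y), w) + g(y, Γ(y, w)). The second, with `euler₂` at (w, 0), gives
  -- ∂_z F(w) = 2 g(y, Γ(y, w)). Eliminating g(y, Γ(y, w)) leaves the Euler-Lagrange expression.
  have k1 := hcomp y y w
  have k2 := hcomp w y y
  rw [L.cartanCoord_self p h, L.euler₃_horizontal p h] at k1 k2
  have e := L.euler₂ p h w 0
  have hz : fderiv ℝ (L.coordFun p) (z, y) (0, 0) = 0 := map_zero (fderiv ℝ (L.coordFun p) (z, y))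
  have hg : ∀ u v, L.gCoord p z y u v = L.gCoord p z y v u := fun u v => by
    rw [L.gCoord_eq p h, L.gCoord_eq p h, fderiv₂_symm hU hF0 h]
  have hadd : L.gCoord p z y w (a + Γ y y) = L.gCoord p z y w a + L.gCoord p z y w (Γ y y) := by
    rw [L.gCoord_eq p h, L.gCoord_eq p h, L.gCoord_eq p h]
    have : ((0 : E), a + Γ y y) = (0, a) + (0, Γ y y) := by simp
    rw [this, map_add]; ring
  have hsplit : (y, a) = (y, (0 : E)) + ((0 : E), a) := by simp
  have hgy := hg y (Γ w y)
  rw [hsymm w y] at hgy k2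
  rw [hadd, hg w (Γ y y), hg w a, L.gCoord_eq p h a w, eulerLagrange, hsplit, map_add,
    add_apply]
  dsimp only at e k1 k2 ⊢
  rw [hz] at e
  linarith

theorem PseudoFinslerMetric.coordFun_nondegenerate {q : E × E} (hq : q ∈ L.coordDomain p) (u : E)
    (hu : ∀ w, fderiv ℝ (fderiv ℝ (L.coordFun p)) q (0, u) (0, w) = 0) : u = 0 :=
  L.gCoord_nondegenerate p (z := q.1) (y := q.2) hq fun w => by
    rw [L.gCoord_eq p hq, hu w, mul_zero]

end Spray

/-! ### Charts, components and transition maps. -/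

section Coordinates

variable {E : Type*} [NormedAddCommGroup E] [NormedSpace ℝ E]
  {M : Type*} [TopologicalSpace M] [ChartedSpace E M]

theorem extChartAt_symm_apply {p x : M} (h : x ∈ (chartAt E p).source) :
    (extChartAt 𝓘(ℝ, E) p).symm (extChartAt 𝓘(ℝ, E) p x) = x :=
  (extChartAt 𝓘(ℝ, E) p).left_inv (by simpa using h)

/-- The transition map between the preferred charts at `p` and at `p'`. -/
def chartChange (p p' : M) : E → E :=
  extChartAt 𝓘(ℝ, E) p' ∘ (extChartAt 𝓘(ℝ, E) p).symm

/-- The domain of the transition map between the preferred charts at `p` and at `p'`. -/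
def chartOverlap (p p' : M) : Set E :=
  ((extChartAt 𝓘(ℝ, E) p).symm ≫ extChartAt 𝓘(ℝ, E) p').source

theorem isOpen_chartOverlap (p p' : M) : IsOpen (chartOverlap (E := E) p p') := by
  rw [chartOverlap, PartialEquiv.trans_source]
  exact (continuousOn_extChartAt_symm p).isOpen_inter_preimage (isOpen_extChartAt_target p)
    (isOpen_extChartAt_source p')

theorem mem_chartOverlap {p p' x : M} (h : x ∈ (chartAt E p).source)
    (h' : x ∈ (chartAt E p').source) : extChartAt 𝓘(ℝ, E) p x ∈ chartOverlap (E := E) p p' := by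
  rw [chartOverlap, PartialEquiv.trans_source]
  refine ⟨(extChartAt 𝓘(ℝ, E) p).map_source (by simpa using h), ?_⟩
  rw [mem_preimage, extChartAt_symm_apply h]
  simpa using h'

theorem chartChange_apply {p p' x : M} (h : x ∈ (chartAt E p).source) :
    chartChange (E := E) p p' (extChartAt 𝓘(ℝ, E) p x) = extChartAt 𝓘(ℝ, E) p' x := by
  rw [chartChange, Function.comp_apply, extChartAt_symm_apply h]

variable [IsManifold 𝓘(ℝ, E) ∞ M]

theorem toCoord_eq {p : M} {v : TangentBundle 𝓘(ℝ, E) M} (h : v.proj ∈ (chartAt E p).source) :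
    toCoord p v = (trivializationAt E (TangentSpace 𝓘(ℝ, E)) p).continuousLinearMapAt ℝ
      v.proj v.snd := by
  have hb : v.proj ∈ (trivializationAt E (TangentSpace 𝓘(ℝ, E)) p).baseSet := h
  rw [Trivialization.continuousLinearMapAt_apply, Trivialization.coe_linearMapAt_of_mem _ hb]
  rfl

theorem toCoord_eq_mfderiv {p x : M} (h : x ∈ (chartAt E p).source)
    (u : TangentSpace 𝓘(ℝ, E) x) :
    toCoord p ⟨x, u⟩ = mfderiv 𝓘(ℝ, E) 𝓘(ℝ, E) (extChartAt 𝓘(ℝ, E) p) x u := by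
  rw [toCoord_eq h, TangentBundle.continuousLinearMapAt_trivializationAt h]
  rfl

theorem toCoord_smul {p x : M} (h : x ∈ (chartAt E p).source)
    (c : ℝ) (u : TangentSpace 𝓘(ℝ, E) x) : toCoord p ⟨x, c • u⟩ = c • toCoord p ⟨x, u⟩ := by
  rw [toCoord_eq h, toCoord_eq h, map_smul]

theorem toCoord_symmL {p x : M} (h : x ∈ (chartAt E p).source) (u : E) :
    toCoord p ⟨x, (trivializationAt E (TangentSpace 𝓘(ℝ, E)) p).symmL ℝ x u⟩ = u := by
  rw [toCoord_eq h]
  exact Trivialization.continuousLinearMapAt_symmL _ h u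

theorem symmL_toCoord {p x : M} (h : x ∈ (chartAt E p).source) (u : TangentSpace 𝓘(ℝ, E) x) :
    (trivializationAt E (TangentSpace 𝓘(ℝ, E)) p).symmL ℝ x (toCoord p ⟨x, u⟩) = u := by
  rw [toCoord_eq h]
  exact Trivialization.symmL_continuousLinearMapAt _ h u

theorem toCoord_fromCoord (p : M) {z : E} (hz : z ∈ (extChartAt 𝓘(ℝ, E) p).target) (y : E) :
    toCoord p (fromCoord p z y) = y :=
  toCoord_symmL (by simpa using (extChartAt 𝓘(ℝ, E) p).map_target hz) y

theorem fromCoord_toCoord {p : M} {v : TangentBundle 𝓘(ℝ, E) M}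
    (h : v.proj ∈ (chartAt E p).source) :
    fromCoord p (extChartAt 𝓘(ℝ, E) p v.proj) (toCoord p v) = v := by
  -- The base point recovered from the chart equals `v.proj` only propositionally, while the fibre
  -- depends on it; the identity is therefore stated for a variable x.
  have : ∀ x : M, x = v.proj → (⟨x, (trivializationAt E (TangentSpace 𝓘(ℝ, E)) p).symmL ℝ x
      (toCoord p v)⟩ : TangentBundle 𝓘(ℝ, E) M) = v := by
    rintro x rfl
    exact congrArg (Bundle.TotalSpace.mk v.proj) (symmL_toCoord h v.snd)
  exact this _ (extChartAt_symm_apply h)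

theorem contDiffOn_chartChange (p p' : M) :
    ContDiffOn ℝ ∞ (chartChange (E := E) p p') (chartOverlap p p') :=
  contDiffOn_ext_coord_change p' p

theorem toCoord_change {p p' x : M} (h : x ∈ (chartAt E p).source)
    (h' : x ∈ (chartAt E p').source) (u : TangentSpace 𝓘(ℝ, E) x) :
    toCoord p' ⟨x, u⟩ =
      fderiv ℝ (chartChange p p') (extChartAt 𝓘(ℝ, E) p x) (toCoord p ⟨x, u⟩) := by
  have hev : extChartAt 𝓘(ℝ, E) p' =ᶠ[𝓝 x] chartChange p p' ∘ extChartAt 𝓘(ℝ, E) p := by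
    filter_upwards [(chartAt E p).open_source.mem_nhds h] with r hr
    exact (chartChange_apply hr).symm
  have hd := differentiableAt_of_mem (isOpen_chartOverlap p p') (contDiffOn_chartChange p p')
    (mem_chartOverlap h h')
  rw [toCoord_eq_mfderiv h, toCoord_eq_mfderiv h', hev.mfderiv_eq,
    mfderiv_comp x hd.mdifferentiableAt (mdifferentiableAt_extChartAt h), mfderiv_eq_fderiv]
  rfl

/-- This is the relation between Lagrangians that `eulerLagrange_comp` asks for, with φ the
transition map. -/
theorem PseudoFinslerMetric.coordFun_change (L : PseudoFinslerMetric E M) (p p' : M) {q : E × E}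
    (hq : q.1 ∈ chartOverlap p p') :
    L.coordFun p q = L.coordFun p' (chartChange p p' q.1, fderiv ℝ (chartChange p p') q.1 q.2) := by
  have hq' := hq
  rw [chartOverlap, PartialEquiv.trans_source] at hq'
  obtain ⟨h1, h2⟩ := hq'
  have s1 : (fromCoord p q.1 q.2).proj ∈ (chartAt E p).source := by
    rw [← extChartAt_source 𝓘(ℝ, E)]
    exact (extChartAt 𝓘(ℝ, E) p).map_target h1
  have s2 : (fromCoord p q.1 q.2).proj ∈ (chartAt E p').source := by
    rw [← extChartAt_source 𝓘(ℝ, E)]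
    exact h2
  have h3 := toCoord_change s1 s2 (fromCoord p q.1 q.2).snd
  have h4 : extChartAt 𝓘(ℝ, E) p (fromCoord p q.1 q.2).proj = q.1 :=
    (extChartAt 𝓘(ℝ, E) p).right_inv h1
  rw [h4] at h3
  have h5 : toCoord p' (fromCoord p q.1 q.2) = fderiv ℝ (chartChange p p') q.1 q.2 :=
    h3.trans (congrArg _ (toCoord_fromCoord p h1 q.2))
  rw [PseudoFinslerMetric.coordFun, PseudoFinslerMetric.coordFun, ← h5]
  exact congrArg L.toFun (fromCoord_toCoord s2).symm

theorem PseudoFinslerMetric.mem_coordDomain (L : PseudoFinslerMetric E M) {p : M}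
    {v : TangentBundle 𝓘(ℝ, E) M} (h : v.proj ∈ (chartAt E p).source) (hv : v ∈ L.domain) :
    (extChartAt 𝓘(ℝ, E) p v.proj, toCoord p v) ∈ L.coordDomain p := by
  refine ⟨(extChartAt 𝓘(ℝ, E) p).map_source (by simpa using h), ?_⟩
  dsimp only
  rw [fromCoord_toCoord h]
  exact hv

theorem PseudoFinslerMetric.g_eq_gCoord (L : PseudoFinslerMetric E M) {p : M}
    {v : TangentBundle 𝓘(ℝ, E) M} (h : v.proj ∈ (chartAt E p).source)
    (u w : TangentSpace 𝓘(ℝ, E) v.proj) :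
    L.g v u w = L.gCoord p (extChartAt 𝓘(ℝ, E) p v.proj) (toCoord p v) (toCoord p ⟨v.proj, u⟩)
      (toCoord p ⟨v.proj, w⟩) := by
  let S := fun x : M => (trivializationAt E (TangentSpace 𝓘(ℝ, E)) p).symmL ℝ x
  have : ∀ x : M, x = v.proj → L.g v u w = L.g ⟨x, S x (toCoord p v)⟩
      (S x (toCoord p ⟨v.proj, u⟩)) (S x (toCoord p ⟨v.proj, w⟩)) := by
    rintro x rfl
    have h1 : S v.proj (toCoord p v) = v.snd := symmL_toCoord h v.snd
    have h2 : S v.proj (toCoord p ⟨v.proj, u⟩) = u := symmL_toCoord h u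
    have h3 : S v.proj (toCoord p ⟨v.proj, w⟩) = w := symmL_toCoord h w
    rw [h1, h2, h3]
  exact this _ (extChartAt_symm_apply h)

theorem PseudoFinslerMetric.g_symm (L : PseudoFinslerMetric E M)
    {v : TangentBundle 𝓘(ℝ, E) M} (hv : v ∈ L.domain)
    (u w : TangentSpace 𝓘(ℝ, E) v.proj) : L.g v u w = L.g v w u := by
  have h := mem_chart_source E v.proj
  have hd := L.mem_coordDomain h hv
  rw [L.g_eq_gCoord h, L.g_eq_gCoord h, L.gCoord_eq _ hd, L.gCoord_eq _ hd,
    fderiv₂_symm (L.isOpen_coordDomain _) (L.contDiffOn_coordFun _) hd]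

theorem PseudoFinslerMetric.g_smul_left (L : PseudoFinslerMetric E M)
    {v : TangentBundle 𝓘(ℝ, E) M} (hv : v ∈ L.domain) (c : ℝ)
    (u w : TangentSpace 𝓘(ℝ, E) v.proj) : L.g v (c • u) w = c * L.g v u w := by
  have h := mem_chart_source E v.proj
  have hd := L.mem_coordDomain h hv
  have hc (x : E) : ((0 : E), c • x) = c • ((0 : E), x) := by simp
  rw [L.g_eq_gCoord h, L.g_eq_gCoord h, L.gCoord_eq _ hd, L.gCoord_eq _ hd, toCoord_smul h, hc,
    map_smul, smul_apply, smul_eq_mul]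
  ring

theorem PseudoFinslerMetric.g_zero_left (L : PseudoFinslerMetric E M)
    {v : TangentBundle 𝓘(ℝ, E) M} (hv : v ∈ L.domain)
    (w : TangentSpace 𝓘(ℝ, E) v.proj) : L.g v 0 w = 0 := by
  simpa using L.g_smul_left hv 0 0 w

theorem PseudoFinslerMetric.g_zero_right (L : PseudoFinslerMetric E M)
    {v : TangentBundle 𝓘(ℝ, E) M} (hv : v ∈ L.domain)
    (u : TangentSpace 𝓘(ℝ, E) v.proj) : L.g v u 0 = 0 := by
  rw [L.g_symm hv, L.g_zero_left hv]

end Coordinates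

/-! ### Velocity lifts and the Euler-Lagrange expression of a curve. -/

section Velocity

variable {E : Type*} [NormedAddCommGroup E] [NormedSpace ℝ E]
  {M : Type*} [TopologicalSpace M] [ChartedSpace E M]
  {γ : ℝ → M} {s : Set ℝ}

theorem velocity_mono {s' : Set ℝ} {t : ℝ} (hγ : MDifferentiableWithinAt 𝓘(ℝ, ℝ) 𝓘(ℝ, E) γ s' t)
    (hs : UniqueDiffWithinAt ℝ s t) (hss' : s ⊆ s') :
    velocity (E := E) γ s t = velocity γ s' t := by
  rw [velocity, velocity, hγ.mfderivWithin_mono hs.uniqueMDiffWithinAt hss']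

variable [IsManifold 𝓘(ℝ, E) ∞ M]

theorem toCoord_velocityLift {p : M} {t : ℝ} (hs : UniqueDiffWithinAt ℝ s t)
    (hγ : MDifferentiableWithinAt 𝓘(ℝ, ℝ) 𝓘(ℝ, E) γ s t) (h : γ t ∈ (chartAt E p).source) :
    toCoord p (velocityLift γ s t) = derivWithin (fun r => extChartAt 𝓘(ℝ, E) p (γ r)) s t := by
  rw [velocityLift, toCoord_eq_mfderiv h, ← fderivWithin_derivWithin, ← mfderivWithin_eq_fderivWithin]
  have := mfderiv_comp_mfderivWithin t (mdifferentiableAt_extChartAt (I := 𝓘(ℝ, E)) h) hγ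
    hs.uniqueMDiffWithinAt
  exact (congrArg (fun T : ℝ →L[ℝ] E => T 1) this).symm

/-- The velocity lift is the tangent map of γ composed with the unit section t ↦ (t, 1) of Tℝ. -/
theorem contMDiffOn_velocityLift (hs : UniqueDiffOn ℝ s)
    (hγ : ContMDiffOn 𝓘(ℝ, ℝ) 𝓘(ℝ, E) ∞ γ s) :
    ContMDiffOn 𝓘(ℝ, ℝ) 𝓘(ℝ, E).tangent ∞ (velocityLift (E := E) γ s) s := by
  have h1 := hγ.contMDiffOn_tangentMapWithin (m := ∞) (by simp) hs.uniqueMDiffOn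
  have h2 : ContMDiff 𝓘(ℝ, ℝ) 𝓘(ℝ, ℝ).tangent ∞
      (fun t : ℝ => (⟨t, (1 : ℝ)⟩ : TangentBundle 𝓘(ℝ, ℝ) ℝ)) := by
    intro t
    rw [contMDiffAt_totalSpace]
    refine ⟨contMDiffAt_id, ?_⟩
    simpa using contMDiffAt_const
  exact h1.comp h2.contMDiffOn (fun t ht => ht)

theorem contDiffWithinAt_toCoord {p : M} {V : ∀ t : ℝ, TangentSpace 𝓘(ℝ, E) (γ t)} {t : ℝ}
    (hV : ContMDiffWithinAt 𝓘(ℝ, ℝ) 𝓘(ℝ, E).tangent ∞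
      (fun t => (⟨γ t, V t⟩ : TangentBundle 𝓘(ℝ, E) M)) s t)
    (h : γ t ∈ (chartAt E p).source) :
    ContDiffWithinAt ℝ ∞ (fun r => toCoord p ⟨γ r, V r⟩) s t := by
  rw [← contMDiffWithinAt_iff_contDiffWithinAt]
  have he : (⟨γ t, V t⟩ : TangentBundle 𝓘(ℝ, E) M) ∈
      (trivializationAt E (TangentSpace 𝓘(ℝ, E)) p).source := by
    rw [Trivialization.mem_source]; exact h
  exact ((Trivialization.contMDiffWithinAt_iff (IB := 𝓘(ℝ, E))
    (f := fun r => (⟨γ r, V r⟩ : TangentBundle 𝓘(ℝ, E) M)) he).1 hV).2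

theorem contDiffWithinAt_chart {p : M} {t : ℝ}
    (hγ : ContMDiffWithinAt 𝓘(ℝ, ℝ) 𝓘(ℝ, E) ∞ γ s t) (h : γ t ∈ (chartAt E p).source) :
    ContDiffWithinAt ℝ ∞ (fun r => extChartAt 𝓘(ℝ, E) p (γ r)) s t := by
  rw [← contMDiffWithinAt_iff_contDiffWithinAt]
  exact (contMDiffAt_extChartAt' h).comp_contMDiffWithinAt t hγ

variable (L : PseudoFinslerMetric E M)

/-- The Euler-Lagrange expression of a curve in the preferred chart at `p`. -/
def PseudoFinslerMetric.curveEL (p : M) (γ : ℝ → M) (s : Set ℝ) (t : ℝ) (w : E) : ℝ :=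
  eulerLagrange (L.coordFun p) (extChartAt 𝓘(ℝ, E) p (γ t), toCoord p (velocityLift γ s t))
    (derivWithin (fun r => toCoord p (velocityLift γ s r)) s t) w

variable {L}

/-- EL is a covector along γ, so a covariant derivative taken in the chart centred at γ t can be
studied, for all nearby t, in a single chart. -/
theorem PseudoFinslerMetric.curveEL_change (hs : UniqueDiffOn ℝ s)
    (hγ : ContMDiffOn 𝓘(ℝ, ℝ) 𝓘(ℝ, E) ∞ γ s) {t : ℝ} (ht : t ∈ s)
    (hA : velocityLift γ s t ∈ L.domain) {p p' : M} (hp : γ t ∈ (chartAt E p).source)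
    (hp' : γ t ∈ (chartAt E p').source) (w : E) :
    L.curveEL p γ s t w = L.curveEL p' γ s t
      (fderiv ℝ (chartChange p p') (extChartAt 𝓘(ℝ, E) p (γ t)) w) := by
  have hd' := L.mem_coordDomain (v := velocityLift γ s t) hp' hA
  have hO := isOpen_chartOverlap (E := E) p p'
  have hφ := contDiffOn_chartChange (E := E) p p'
  have hmem : extChartAt 𝓘(ℝ, E) p (γ t) ∈ chartOverlap (E := E) p p' := mem_chartOverlap hp hp'
  have hv : toCoord p' (velocityLift γ s t) = fderiv ℝ (chartChange p p')
      (extChartAt 𝓘(ℝ, E) p (γ t)) (toCoord p (velocityLift γ s t)) :=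
    toCoord_change hp hp' (velocity γ s t)
  have hev : ∀ᶠ r in 𝓝[s] t, toCoord p' (velocityLift γ s r) =
      fderiv ℝ (chartChange p p') (extChartAt 𝓘(ℝ, E) p (γ r)) (toCoord p (velocityLift γ s r)) := by
    have h1 := (hγ t ht).continuousWithinAt.eventually ((chartAt E p).open_source.mem_nhds hp)
    have h2 := (hγ t ht).continuousWithinAt.eventually ((chartAt E p').open_source.mem_nhds hp')
    filter_upwards [h1, h2] with r hr hr' using toCoord_change hr hr' (velocity γ s r)
  have hz := ((contDiffWithinAt_chart (hγ t ht) hp).differentiableWithinAt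
    (by simp)).hasDerivWithinAt
  rw [← toCoord_velocityLift (hs t ht) ((hγ t ht).mdifferentiableWithinAt (by simp)) hp] at hz
  have hy := ((contDiffWithinAt_toCoord (contMDiffOn_velocityLift hs hγ t ht)
    hp).differentiableWithinAt (by simp)).hasDerivWithinAt
  have hφz := (hasFDerivAt_of_mem hO (contDiffOn_fderiv_infty hO hφ) hmem).comp_hasDerivWithinAt t hz
  -- Product rule for the velocity Dφ(z) y in the new chart: the acceleration becomes Dφ a + D²φ(y,
  -- y), as in `eulerLagrange_comp`.
  have hacc := ((hφz.clm_apply hy).congr_of_eventuallyEq hev hv).derivWithin (hs t ht)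
  have hcc : chartChange p p' (extChartAt 𝓘(ℝ, E) p (γ t)) = extChartAt 𝓘(ℝ, E) p' (γ t) :=
    chartChange_apply hp
  rw [PseudoFinslerMetric.curveEL, PseudoFinslerMetric.curveEL, hacc, hv, ← hcc,
    eulerLagrange_comp (L.isOpen_coordDomain p') (L.contDiffOn_coordFun p') hO hφ
      (q := (extChartAt 𝓘(ℝ, E) p (γ t), toCoord p (velocityLift γ s t))) hmem]
  · congr 1
    exact add_comm _ _
  · dsimp only
    rw [hcc, ← hv]
    exact hd'
  · filter_upwards [continuousAt_fst.eventually (hO.mem_nhds hmem)] with q hq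
    exact L.coordFun_change p p' hq

variable [FiniteDimensional ℝ E]

/-- The covariant derivative of the velocity, paired with a vector, is the Euler-Lagrange
expression in any chart. -/
theorem PseudoFinslerMetric.g_covDeriv (hs : UniqueDiffOn ℝ s)
    (hγ : ContMDiffOn 𝓘(ℝ, ℝ) 𝓘(ℝ, E) ∞ γ s) {t : ℝ} (ht : t ∈ s)
    (hA : velocityLift γ s t ∈ L.domain) {p : M} (hp : γ t ∈ (chartAt E p).source)
    (w : TangentSpace 𝓘(ℝ, E) (γ t)) :
    L.g (velocityLift γ s t) w (L.covDeriv γ s (velocity γ s) (velocity γ s) t) =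
      1 / 2 * L.curveEL p γ s t (toCoord p ⟨γ t, w⟩) := by
  have h₀ : γ t ∈ (chartAt E (γ t)).source := mem_chart_source E (γ t)
  have hd₀ := L.mem_coordDomain (v := velocityLift γ s t) h₀ hA
  rw [L.curveEL_change hs hγ ht hA hp h₀, ← toCoord_change hp h₀ w]
  refine (L.g_eq_gCoord (v := velocityLift γ s t) h₀ _ _).trans ?_
  refine Eq.trans ?_ (L.gCoord_christoffel (γ t) hd₀ _ _)
  congr 1
  exact toCoord_symmL h₀ _

end Velocity

/-! ### Continuity of the Euler-Lagrange expression and test fields supported in a chart. -/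

section Fields

variable {E : Type*} [NormedAddCommGroup E] [NormedSpace ℝ E]
  {M : Type*} [TopologicalSpace M] [ChartedSpace E M]
  {γ : ℝ → M} {s : Set ℝ}

theorem zero_mem_tangentSpaceOf {EP : Type*} [NormedAddCommGroup EP] [NormedSpace ℝ EP] {P : Set M}
    [ChartedSpace EP P] {p : M} (hp : p ∈ P) :
    (0 : TangentSpace 𝓘(ℝ, E) p) ∈ tangentSpaceOf (EP := EP) P p :=
  ⟨hp, 0, map_zero _⟩

variable [IsManifold 𝓘(ℝ, E) ∞ M]

/-- With p and w fixed, everything is a continuous function of position, velocity and acceleration.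
This serves to propagate a sign to nearby times and to integrate. -/
theorem PseudoFinslerMetric.continuousWithinAt_curveEL {L : PseudoFinslerMetric E M}
    (hs : UniqueDiffOn ℝ s) (hγ : ContMDiffOn 𝓘(ℝ, ℝ) 𝓘(ℝ, E) ∞ γ s) {t : ℝ} (ht : t ∈ s)
    (hA : velocityLift γ s t ∈ L.domain) {p : M} (hp : γ t ∈ (chartAt E p).source) (w : E) :
    ContinuousWithinAt (fun r => L.curveEL p γ s r w) s t := by
  have hU := L.isOpen_coordDomain p
  have hF1 := contDiffOn_fderiv_infty hU (L.contDiffOn_coordFun p)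
  have hF2 := contDiffOn_fderiv_infty hU hF1
  have hd : L.coordDomain p ∈ 𝓝 (extChartAt 𝓘(ℝ, E) p (γ t), toCoord p (velocityLift γ s t)) :=
    hU.mem_nhds (L.mem_coordDomain (v := velocityLift γ s t) hp hA)
  have hy : ContDiffWithinAt ℝ ∞ (fun r => toCoord p (velocityLift γ s r)) s t :=
    contDiffWithinAt_toCoord (contMDiffOn_velocityLift hs hγ t ht) hp
  have ha : ContinuousWithinAt (derivWithin (fun r => toCoord p (velocityLift γ s r)) s) s t :=
    (hy.fderivWithin_right (m := 0) hs (by simp) ht).continuousWithinAt.clm_apply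
      continuousWithinAt_const
  have hq : ContinuousWithinAt (fun r => (extChartAt 𝓘(ℝ, E) p (γ r),
      toCoord p (velocityLift γ s r))) s t :=
    (contDiffWithinAt_chart (hγ t ht) hp).continuousWithinAt.prodMk hy.continuousWithinAt
  have h1 := ContinuousAt.comp_continuousWithinAt
    (f := fun r => (extChartAt 𝓘(ℝ, E) p (γ r), toCoord p (velocityLift γ s r)))
    (hF1.continuousOn.continuousAt hd) hq
  have h2 := ContinuousAt.comp_continuousWithinAt
    (f := fun r => (extChartAt 𝓘(ℝ, E) p (γ r), toCoord p (velocityLift γ s r)))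
    (hF2.continuousOn.continuousAt hd) hq
  exact ((h2.clm_apply (hy.continuousWithinAt.prodMk ha)).clm_apply
    continuousWithinAt_const).sub (h1.clm_apply continuousWithinAt_const)

/-- The vector field along a curve with components `φ(t) w` in the preferred chart at `p`. -/
def chartField (p : M) (γ : ℝ → M) (φ : ℝ → ℝ) (w : E) (t : ℝ) : TangentSpace 𝓘(ℝ, E) (γ t) :=
  φ t • (trivializationAt E (TangentSpace 𝓘(ℝ, E)) p).symmL ℝ (γ t) w

theorem toCoord_chartField {p : M} {t : ℝ} (hp : γ t ∈ (chartAt E p).source) (φ : ℝ → ℝ) (w : E) :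
    toCoord p ⟨γ t, chartField p γ φ w t⟩ = φ t • w := by
  rw [chartField, toCoord_smul hp, toCoord_symmL hp]

/-- On the support of φ the trivialization at p applies; off it the field is locally zero. Hence γ
may leave the chart wherever φ vanishes. -/
theorem contMDiffOn_chartField {p : M} {φ : ℝ → ℝ} (hγ : ContMDiffOn 𝓘(ℝ, ℝ) 𝓘(ℝ, E) ∞ γ s)
    (hφ : ContDiff ℝ ∞ φ) (hp : ∀ t ∈ s, t ∈ tsupport φ → γ t ∈ (chartAt E p).source) (w : E) :
    ContMDiffOn 𝓘(ℝ, ℝ) 𝓘(ℝ, E).tangent ∞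
      (fun t => (⟨γ t, chartField p γ φ w t⟩ : TangentBundle 𝓘(ℝ, E) M)) s := by
  intro t ht
  by_cases hsupp : t ∈ tsupport φ
  · have hpt := hp t ht hsupp
    have he : (⟨γ t, chartField p γ φ w t⟩ : TangentBundle 𝓘(ℝ, E) M) ∈
        (trivializationAt E (TangentSpace 𝓘(ℝ, E)) p).source := by
      rw [Trivialization.mem_source]; exact hpt
    refine (Trivialization.contMDiffWithinAt_iff (IB := 𝓘(ℝ, E))
      (f := fun r => (⟨γ r, chartField p γ φ w r⟩ : TangentBundle 𝓘(ℝ, E) M)) he).2 ⟨hγ t ht, ?_⟩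
    have h1 : ContMDiffWithinAt 𝓘(ℝ, ℝ) 𝓘(ℝ, E) ∞ (fun r => φ r • w) s t :=
      (hφ.smul contDiff_const).contMDiff.contMDiffAt.contMDiffWithinAt
    refine h1.congr_of_eventuallyEq ?_ (toCoord_chartField hpt φ w)
    filter_upwards [(hγ t ht).continuousWithinAt.eventually
      ((chartAt E p).open_source.mem_nhds hpt)] with r hr using toCoord_chartField hr φ w
  · have h0 : ∀ᶠ r in 𝓝 t, chartField p γ φ w r = 0 := by
      filter_upwards [(isClosed_tsupport φ).isOpen_compl.mem_nhds hsupp] with r hr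
      rw [chartField, image_eq_zero_of_notMem_tsupport hr, zero_smul]
    have h1 : ContMDiffWithinAt 𝓘(ℝ, ℝ) 𝓘(ℝ, E).tangent ∞
        (fun r => (⟨γ r, 0⟩ : TangentBundle 𝓘(ℝ, E) M)) s t :=
      ((Bundle.contMDiff_zeroSection ℝ (TangentSpace 𝓘(ℝ, E) : M → Type _)).contMDiffAt
        (n := ∞)).comp_contMDiffWithinAt t (hγ t ht)
    refine h1.congr_of_eventuallyEq ?_ ?_
    · filter_upwards [mem_nhdsWithin_of_mem_nhds h0] with r hr
      rw [hr]
    · rw [h0.self_of_nhds]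

end Fields

/-! ### Combinatorics of subdivisions. -/

section Subdivision

variable {a b : ℝ} {h : ℕ} (τ : Subdivision a b h)

theorem Subdivision.castSucc_lt_succ (i : Fin (h + 1)) : τ.pt i.castSucc < τ.pt i.succ :=
  τ.strictMono (Fin.castSucc_lt_succ)

theorem Subdivision.lt {a b : ℝ} {h : ℕ} (τ : Subdivision a b h) : a < b := by
  have := τ.strictMono (Fin.last_pos : (0 : Fin (h + 2)) < Fin.last (h + 1))
  rwa [τ.first, τ.last] at this

theorem Subdivision.pt_mem (j : Fin (h + 2)) : τ.pt j ∈ Icc a b := by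
  constructor
  · exact τ.first.ge.trans (τ.strictMono.monotone (Fin.zero_le j))
  · exact (τ.strictMono.monotone (Fin.le_last j)).trans τ.last.le

theorem Subdivision.piece_subset (i : Fin (h + 1)) : τ.piece i ⊆ Icc a b :=
  Icc_subset_Icc (τ.pt_mem _).1 (τ.pt_mem _).2

theorem Subdivision.uniqueDiffOn_piece (i : Fin (h + 1)) : UniqueDiffOn ℝ (τ.piece i) :=
  uniqueDiffOn_Icc (τ.castSucc_lt_succ i)

theorem Subdivision.exists_mem_piece {t : ℝ} (ht : t ∈ Icc a b) : ∃ i, t ∈ τ.piece i := by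
  by_contra! hcon
  -- A point outside all pieces passes each node in turn, which puts it in the last piece after all.
  have key : ∀ i : Fin (h + 2), τ.pt i ≤ t := by
    intro i
    induction i using Fin.induction with
    | zero => rw [τ.first]; exact ht.1
    | succ i ih =>
      by_contra! hlt
      exact hcon i ⟨ih, hlt.le⟩
  refine hcon (Fin.last h) ⟨key _, ?_⟩
  rw [Fin.succ_last, τ.last]
  exact ht.2

theorem Subdivision.iUnion_piece : ⋃ i, τ.piece i = Icc a b :=
  (iUnion_subset τ.piece_subset).antisymm fun _ ht => mem_iUnion.2 (τ.exists_mem_piece ht)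

theorem Subdivision.pt_notMem_Ioo (i : Fin (h + 1)) (j : Fin (h + 2)) :
    τ.pt j ∉ Ioo (τ.pt i.castSucc) (τ.pt i.succ) := by
  rintro ⟨h1, h2⟩
  rw [τ.strictMono.lt_iff_lt] at h1 h2
  simp only [Fin.lt_def, Fin.val_castSucc, Fin.val_succ] at h1 h2
  omega

theorem Subdivision.notMem_Ioo_of_mem_piece {i j : Fin (h + 1)} (hij : j ≠ i) {t : ℝ}
    (ht : t ∈ τ.piece j) : t ∉ Ioo (τ.pt i.castSucc) (τ.pt i.succ) := by
  rintro ⟨h1, h2⟩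
  rcases lt_or_gt_of_ne hij with hlt | hlt
  · have : τ.pt j.succ ≤ τ.pt i.castSucc := τ.strictMono.monotone (by
      simp only [Fin.le_def, Fin.lt_def, Fin.val_castSucc, Fin.val_succ] at *; omega)
    linarith [ht.2]
  · have : τ.pt i.succ ≤ τ.pt j.castSucc := τ.strictMono.monotone (by
      simp only [Fin.le_def, Fin.lt_def, Fin.val_castSucc, Fin.val_succ] at *; omega)
    linarith [ht.1]

theorem Subdivision.pt_castSucc_mem_piece (i : Fin (h + 1)) : τ.pt i.castSucc ∈ τ.piece i :=
  left_mem_Icc.2 (τ.castSucc_lt_succ i).le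

theorem Subdivision.pt_succ_mem_piece (i : Fin (h + 1)) : τ.pt i.succ ∈ τ.piece i :=
  right_mem_Icc.2 (τ.castSucc_lt_succ i).le

theorem Subdivision.left_mem_piece : a ∈ τ.piece 0 := by
  have := τ.pt_castSucc_mem_piece 0
  rwa [Fin.castSucc_zero, τ.first] at this

theorem Subdivision.right_mem_piece : b ∈ τ.piece (Fin.last h) := by
  have := τ.pt_succ_mem_piece (Fin.last h)
  rwa [Fin.succ_last, τ.last] at this

theorem Subdivision.continuousOn {X : Type*} [TopologicalSpace X] {f : ℝ → X}
    (hf : ∀ i, ContinuousOn f (τ.piece i)) : ContinuousOn f (Icc a b) := by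
  rw [← τ.iUnion_piece]
  exact (locallyFinite_of_finite _).continuousOn_iUnion (fun _ => isClosed_Icc) hf

/-- A bump function around a point of a continuous curve, supported in a given neighbourhood and in
the domain of the preferred chart at that point. -/
theorem exists_bump {E : Type*} [NormedAddCommGroup E] [NormedSpace ℝ E] {M : Type*}
    [TopologicalSpace M] [ChartedSpace E M] {γ : ℝ → M} (hγ : ContinuousOn γ (Icc a b)) {c : ℝ}
    (hc : c ∈ Icc a b) {N : Set ℝ} (hN : N ∈ 𝓝 c) :
    ∃ φ : ℝ → ℝ, ContDiff ℝ ∞ φ ∧ (∀ t ∉ N, φ t = 0) ∧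
      (∀ t ∈ Icc a b, t ∈ tsupport φ → γ t ∈ (chartAt E (γ c)).source) ∧ φ c = 1 := by
  have h1 := (hγ c hc).eventually ((chartAt E (γ c)).open_source.mem_nhds (mem_chart_source E (γ c)))
  rw [eventually_nhdsWithin_iff] at h1
  obtain ⟨φ, hφ, -, hφ', -, hφc⟩ := exists_contDiff_tsupport_subset (n := ⊤)
    (Filter.inter_mem hN h1)
  exact ⟨φ, hφ', fun t ht => image_eq_zero_of_notMem_tsupport fun h => ht (hφ h).1,
    fun t ht h => (hφ h).2 ht, hφc⟩

end Subdivision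

/-! ### First variation: the equation on each piece. -/

section Critical

variable {E : Type*} [NormedAddCommGroup E] [NormedSpace ℝ E]
  {M : Type*} [TopologicalSpace M] [ChartedSpace E M] [IsManifold 𝓘(ℝ, E) ∞ M]
  {L : PseudoFinslerMetric E M} {a b : ℝ} {h : ℕ} {τ : Subdivision a b h} {γ : ℝ → M}

/-- Endpoint and break terms see a field only through its values at the nodes. Used for fields
supported inside one piece. -/
theorem PseudoFinslerMetric.dE_eq_of_forall_pt_eq_zero (hγ : L.IsAdmissibleCurve τ γ)
    {W : ∀ t : ℝ, TangentSpace 𝓘(ℝ, E) (γ t)} (hW : ∀ j, W (τ.pt j) = 0) :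
    L.dE τ γ W = -∑ i : Fin (h + 1), ∫ t in (τ.pt i.castSucc)..(τ.pt i.succ),
      L.g (velocityLift γ (τ.piece i) t) (W t)
        (L.covDeriv γ (τ.piece i) (velocity γ (τ.piece i)) (velocity γ (τ.piece i)) t) := by
  have ha : W a = 0 := by have := hW 0; rwa [τ.first] at this
  have hb : W b = 0 := by have := hW (Fin.last _); rwa [τ.last] at this
  have h1 : L.g (velocityLift γ (τ.piece (Fin.last h)) b) (W b)
      (velocity γ (τ.piece (Fin.last h)) b) = 0 := by
    rw [hb]; exact L.g_zero_left (hγ.admissible _ _ τ.right_mem_piece) _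
  have h2 : L.g (velocityLift γ (τ.piece 0) a) (W a) (velocity γ (τ.piece 0) a) = 0 := by
    rw [ha]; exact L.g_zero_left (hγ.admissible _ _ τ.left_mem_piece) _
  have h3 : ∀ i : Fin h,
      ((L.legendre (velocityLift γ (τ.piece i.succ) (τ.pt i.succ.castSucc))).2
          (W (τ.pt i.succ.castSucc))
        - (L.legendre (velocityLift γ (τ.piece i.castSucc) (τ.pt i.succ.castSucc))).2
          (W (τ.pt i.succ.castSucc))) = 0 := by
    intro i
    rw [hW]
    have e1 := L.g_zero_right (hγ.admissible i.succ _ (τ.pt_castSucc_mem_piece i.succ))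
      (velocity γ (τ.piece i.succ) (τ.pt i.succ.castSucc))
    have e2 := L.g_zero_right (hγ.admissible i.castSucc (τ.pt i.succ.castSucc)
      (by rw [← Fin.succ_castSucc]; exact (τ.pt_succ_mem_piece i.castSucc)))
      (velocity γ (τ.piece i.castSucc) (τ.pt i.succ.castSucc))
    exact (congrArg₂ (· - ·) e1 e2).trans (sub_zero 0)
  rw [PseudoFinslerMetric.dE, h1, h2, Finset.sum_eq_zero fun i _ => h3 i]
  ring

/-- Once γ is a geodesic on each piece, only the values of the field at the nodes matter; this
isolates the break and endpoint conditions. -/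
theorem PseudoFinslerMetric.dE_eq_of_parallel (hγ : L.IsAdmissibleCurve τ γ)
    (hpar : ∀ i, ∀ t ∈ τ.piece i,
      L.covDeriv γ (τ.piece i) (velocity γ (τ.piece i)) (velocity γ (τ.piece i)) t = 0)
    (W : ∀ t : ℝ, TangentSpace 𝓘(ℝ, E) (γ t)) :
    L.dE τ γ W = (L.g (velocityLift γ (τ.piece (Fin.last h)) b) (W b)
        (velocity γ (τ.piece (Fin.last h)) b)
      - L.g (velocityLift γ (τ.piece 0) a) (W a) (velocity γ (τ.piece 0) a))
      - ∑ i : Fin h,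
      ((L.legendre (velocityLift γ (τ.piece i.succ) (τ.pt i.succ.castSucc))).2
          (W (τ.pt i.succ.castSucc))
        - (L.legendre (velocityLift γ (τ.piece i.castSucc) (τ.pt i.succ.castSucc))).2
          (W (τ.pt i.succ.castSucc))) := by
  have h1 : ∀ i : Fin (h + 1), ∫ t in (τ.pt i.castSucc)..(τ.pt i.succ),
      L.g (velocityLift γ (τ.piece i) t) (W t)
        (L.covDeriv γ (τ.piece i) (velocity γ (τ.piece i)) (velocity γ (τ.piece i)) t) = 0 := by
    intro i
    rw [intervalIntegral.integral_congr (g := fun _ => (0 : ℝ)), intervalIntegral.integral_zero]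
    intro t ht
    rw [uIcc_of_le (τ.castSucc_lt_succ i).le] at ht
    dsimp only
    rw [hpar i t ht]
    exact L.g_zero_right (hγ.admissible i t ht) _
  rw [PseudoFinslerMetric.dE, Finset.sum_eq_zero fun i _ => h1 i]
  ring

/-- The field concentrated near one point of the subdivision. -/
theorem exists_field_at_pt (hγ : ∀ i, ContMDiffOn 𝓘(ℝ, ℝ) 𝓘(ℝ, E) ∞ γ (τ.piece i))
    (k : Fin (h + 2)) {c : ℝ} (hk : τ.pt k = c) (w : TangentSpace 𝓘(ℝ, E) (γ c)) :
    ∃ W : ∀ t : ℝ, TangentSpace 𝓘(ℝ, E) (γ t), IsPiecewiseSmoothField τ γ W ∧ W c = w ∧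
      ∀ j, j ≠ k → W (τ.pt j) = 0 := by
  subst hk
  -- The finitely many other nodes are kept out of the support of the bump.
  have hN : (τ.pt '' {j | j ≠ k})ᶜ ∈ 𝓝 (τ.pt k) := by
    refine ((toFinite _).isClosed.isOpen_compl).mem_nhds ?_
    rintro ⟨j, hj, hjk⟩
    exact hj (τ.strictMono.injective hjk)
  obtain ⟨φ, hφ, hφN, hφs, hφk⟩ := exists_bump (E := E)
    (τ.continuousOn fun i => (hγ i).continuousOn) (τ.pt_mem k) hN
  refine ⟨chartField (γ (τ.pt k)) γ φ (toCoord (γ (τ.pt k)) ⟨γ (τ.pt k), w⟩), fun i =>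
    contMDiffOn_chartField (hγ i) hφ (fun t ht => hφs t (τ.piece_subset i ht)) _, ?_, ?_⟩
  · rw [chartField, hφk, one_smul, symmL_toCoord (mem_chart_source E _)]
  · intro j hj
    rw [chartField, hφN _ (fun h => h ⟨j, hj, rfl⟩), zero_smul]

variable [FiniteDimensional ℝ E]
  {EP : Type*} [NormedAddCommGroup EP] [NormedSpace ℝ EP] {P : Set M} [ChartedSpace EP P]
  {EQ : Type*} [NormedAddCommGroup EQ] [NormedSpace ℝ EQ] {Q : Set M} [ChartedSpace EQ Q]

/-- The fundamental lemma of the calculus of variations: if D γ̇ were nonzero somewhere,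
nondegeneracy would give a direction where EL is nonzero, and a bump field in that direction would
have nonzero dE. -/
theorem PseudoFinslerMetric.IsCriticalPoint.parallel
    (hcrit : L.IsCriticalPoint τ (EP := EP) P (EQ := EQ) Q γ) (hγ : L.IsCurveJoining τ P Q γ)
    (i : Fin (h + 1)) {t : ℝ} (ht : t ∈ τ.piece i) :
    L.covDeriv γ (τ.piece i) (velocity γ (τ.piece i)) (velocity γ (τ.piece i)) t = 0 := by
  set s := τ.piece i with hsdef
  have hs : UniqueDiffOn ℝ s := τ.uniqueDiffOn_piece i
  have hγs := hγ.smooth i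
  have hAs := hγ.admissible i
  by_contra hne
  obtain ⟨w, hw⟩ : ∃ w : TangentSpace 𝓘(ℝ, E) (γ t), L.curveEL (γ t) γ s t (toCoord (γ t) ⟨γ t, w⟩)
      ≠ 0 := by
    by_contra! hcon
    refine hne (L.nondegenerate _ (hAs t ht) _ fun w => ?_)
    refine (L.g_symm (hAs t ht) _ _).trans ?_
    refine (L.g_covDeriv hs hγs ht (hAs t ht) (mem_chart_source E (γ t)) w).trans ?_
    rw [hcon w, mul_zero]
  obtain ⟨p, hsrc, w₀, hw₀⟩ : ∃ p : M, γ t ∈ (chartAt E p).source ∧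
      ∃ w₀ : E, 0 < L.curveEL p γ s t w₀ := by
    -- Scaling w by the value EL(w) makes the new value EL(w)², which is positive.
    refine ⟨γ t, mem_chart_source E (γ t),
      L.curveEL (γ t) γ s t (toCoord (γ t) ⟨γ t, w⟩) • toCoord (γ t) ⟨γ t, w⟩, ?_⟩
    rw [PseudoFinslerMetric.curveEL, eulerLagrange_smul]
    exact mul_self_pos.2 hw
  have hev := ((L.continuousWithinAt_curveEL hs hγs ht (hAs t ht) hsrc w₀).eventually
    (lt_mem_nhds hw₀)).and ((hγs t ht).continuousWithinAt.eventually
      ((chartAt E p).open_source.mem_nhds hsrc))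
  obtain ⟨U, hU, htU, hUs⟩ := mem_nhdsWithin.1 hev
  set c := τ.pt i.castSucc
  set d := τ.pt i.succ
  have hcd : c < d := τ.castSucc_lt_succ i
  -- The bad time t may be an end of the piece; positivity persists nearby, so it is replaced by an
  -- interior time.
  obtain ⟨t₁, ht₁U, ht₁⟩ : (U ∩ Ioo c d).Nonempty :=
    mem_closure_iff.1 (by rw [closure_Ioo hcd.ne]; exact ht) U hU htU
  obtain ⟨φ, hφN, -, hφ, hφr, hφ₁⟩ := exists_contDiff_tsupport_subset (n := ⊤)
    ((hU.inter isOpen_Ioo).mem_nhds ⟨ht₁U, ht₁⟩)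
  -- Support in the open piece makes the field vanish at all nodes and on all other pieces, so one
  -- integral survives.
  have hφ0 : ∀ r, r ∉ Ioo c d → φ r = 0 := fun r hr =>
    image_eq_zero_of_notMem_tsupport fun h => hr (hφN h).2
  have hφnn : ∀ r, 0 ≤ φ r := fun r => (hφr (mem_range_self r)).1
  have hin : ∀ r ∈ tsupport φ, r ∈ s ∧ 0 < L.curveEL p γ s r w₀ ∧ γ r ∈ (chartAt E p).source :=
    fun r hr => ⟨Ioo_subset_Icc_self (hφN hr).2, hUs ⟨(hφN hr).1, Ioo_subset_Icc_self (hφN hr).2⟩⟩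
  set W := chartField p γ φ w₀
  have hW0 : ∀ r, φ r = 0 → W r = 0 := fun r hr => by
    simp only [W, chartField, hr, zero_smul]
  have hWpt : ∀ j, W (τ.pt j) = 0 := fun j => hW0 _ (hφ0 _ (τ.pt_notMem_Ioo i j))
  have hWa : W a = 0 := by have := hWpt 0; rwa [τ.first] at this
  have hWb : W b = 0 := by have := hWpt (Fin.last _); rwa [τ.last] at this
  have hdE := hcrit W
    (fun j => contMDiffOn_chartField (hγ.smooth j) hφ (fun r _ hr => (hin r hr).2.2) w₀)
    (by rw [hWa]; exact zero_mem_tangentSpaceOf hγ.left_mem)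
    (by rw [hWb]; exact zero_mem_tangentSpaceOf hγ.right_mem)
  rw [L.dE_eq_of_forall_pt_eq_zero hγ.toIsAdmissibleCurve hWpt, neg_eq_zero,
    Finset.sum_eq_single i] at hdE
  · set f : ℝ → ℝ := fun r => L.g (velocityLift γ s r) (W r)
      (L.covDeriv γ s (velocity γ s) (velocity γ s) r)
    have hf : ∀ r ∈ s, f r = φ r * (1 / 2 * L.curveEL p γ s r w₀) := by
      intro r hr
      by_cases hrs : r ∈ tsupport φ
      · refine (L.g_covDeriv hs hγs hr (hAs r hr) (hin r hrs).2.2 (W r)).trans ?_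
        rw [toCoord_chartField (hin r hrs).2.2, PseudoFinslerMetric.curveEL, eulerLagrange_smul,
          PseudoFinslerMetric.curveEL]
        ring
      · have h0 := image_eq_zero_of_notMem_tsupport hrs
        rw [h0, zero_mul]
        simp only [f, hW0 r h0]
        exact L.g_zero_left (hAs r hr) _
    have hpos : 0 < ∫ r in c..d, f r := by
      refine intervalIntegral.integral_pos hcd ?_ ?_ ⟨t₁, Ioo_subset_Icc_self ht₁, ?_⟩
      · refine ContinuousOn.congr ?_ hf
        intro r hr
        by_cases hrs : r ∈ tsupport φ
        · exact hφ.continuous.continuousWithinAt.mul (continuousWithinAt_const.mul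
            (L.continuousWithinAt_curveEL hs hγs hr (hAs r hr) (hin r hrs).2.2 w₀))
        · have h0 : ∀ᶠ x in 𝓝 r, φ x * (1 / 2 * L.curveEL p γ s x w₀) = 0 := by
            filter_upwards [(isClosed_tsupport φ).isOpen_compl.mem_nhds hrs] with x hx
            rw [image_eq_zero_of_notMem_tsupport hx, zero_mul]
          exact ((continuousAt_const (y := (0 : ℝ))).congr
            (h0.mono fun x hx => hx.symm)).continuousWithinAt
      · intro r hr
        rw [hf r (Ioc_subset_Icc_self hr)]
        by_cases hrs : r ∈ tsupport φ
        · have := (hin r hrs).2.1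
          have := hφnn r
          positivity
        · rw [image_eq_zero_of_notMem_tsupport hrs, zero_mul]
      · rw [hf t₁ (Ioo_subset_Icc_self ht₁), hφ₁]
        have := (hin t₁ (subset_tsupport _ (by simp [hφ₁]))).2.1
        positivity
    exact hpos.ne' hdE
  · intro j _ hj
    rw [intervalIntegral.integral_congr (g := fun _ => (0 : ℝ)), intervalIntegral.integral_zero]
    intro r hr
    rw [uIcc_of_le (τ.castSucc_lt_succ j).le] at hr
    dsimp only
    rw [hW0 r (hφ0 r (τ.notMem_Ioo_of_mem_piece hj hr))]
    exact L.g_zero_left (hγ.admissible j r hr) _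
  · exact fun h => absurd (Finset.mem_univ i) h

end Critical

/-! ### Smoothness across a break. -/

section Regularity

/-- Solutions of an autonomous differential equation with smooth right-hand side are smooth. -/
theorem contDiffOn_of_hasDerivAt {X : Type*} [NormedAddCommGroup X] [NormedSpace ℝ X] {U : Set X}
    {Φ : X → X} (hΦ : ContDiffOn ℝ ∞ Φ U) {J : Set ℝ} (hJ : IsOpen J) {x : ℝ → X}
    (hx : ∀ t ∈ J, x t ∈ U) (hd : ∀ t ∈ J, HasDerivAt x (Φ (x t)) t) : ContDiffOn ℝ ∞ x J := by
  rw [contDiffOn_infty]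
  intro n
  induction n with
  | zero => exact contDiffOn_zero.2 fun t ht => (hd t ht).continuousAt.continuousWithinAt
  | succ n ih =>
    push_cast
    rw [contDiffOn_succ_iff_deriv_of_isOpen hJ]
    refine ⟨fun t ht => (hd t ht).differentiableAt.differentiableWithinAt, by simp, ?_⟩
    -- Bootstrapping: the derivative Φ ∘ x has whatever regularity x already has.
    refine ((hΦ.of_le (by exact_mod_cast le_top)).comp ih hx).congr fun t ht => ?_
    exact (hd t ht).deriv

variable {E : Type*} [NormedAddCommGroup E] [NormedSpace ℝ E]
  {M : Type*} [TopologicalSpace M] [ChartedSpace E M] [IsManifold 𝓘(ℝ, E) ∞ M]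
  {L : PseudoFinslerMetric E M} {γ : ℝ → M}

/-- One-sided derivatives on a subinterval agree with those on the larger interval where γ is
smooth; this passes between the pieces and [a, b]. -/
theorem PseudoFinslerMetric.covDeriv_velocity_mono {s s' : Set ℝ} (hs : UniqueDiffOn ℝ s)
    (hs' : UniqueDiffOn ℝ s') (hss' : s ⊆ s') (hγ : ContMDiffOn 𝓘(ℝ, ℝ) 𝓘(ℝ, E) ∞ γ s') {t : ℝ}
    (ht : t ∈ s) :
    L.covDeriv γ s (velocity γ s) (velocity γ s) t =
      L.covDeriv γ s' (velocity γ s') (velocity γ s') t := by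
  have hv : ∀ r ∈ s, velocity (E := E) γ s r = velocity γ s' r := fun r hr =>
    velocity_mono ((hγ r (hss' hr)).mdifferentiableWithinAt (by simp)) (hs r hr) hss'
  have hd : derivWithin (fun r => toCoord (E := E) (γ t) ⟨γ r, velocity γ s r⟩) s t =
      derivWithin (fun r => toCoord (E := E) (γ t) ⟨γ r, velocity γ s' r⟩) s' t := by
    rw [derivWithin_congr (f := fun r => toCoord (E := E) (γ t) ⟨γ r, velocity γ s' r⟩)
      (fun r hr => by dsimp only; rw [hv r hr]) (by rw [hv t ht])]
    exact derivWithin_subset hss' (hs t ht) ((contDiffWithinAt_toCoord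
      (contMDiffOn_velocityLift hs' hγ t (hss' ht))
      (mem_chart_source E (γ t))).differentiableWithinAt (by simp))
  rw [PseudoFinslerMetric.covDeriv, PseudoFinslerMetric.covDeriv, velocityLift, velocityLift, hd,
    hv t ht]

variable [FiniteDimensional ℝ E]

/-- In a chart, the position and velocity of a geodesic solve the second order differential
equation given by the spray. -/
theorem PseudoFinslerMetric.hasDerivWithinAt_of_parallel {s : Set ℝ} (hs : UniqueDiffOn ℝ s)
    (hγ : ContMDiffOn 𝓘(ℝ, ℝ) 𝓘(ℝ, E) ∞ γ s) {t : ℝ} (ht : t ∈ s)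
    (hA : velocityLift γ s t ∈ L.domain) {p : M} (hp : γ t ∈ (chartAt E p).source)
    (hpar : L.covDeriv γ s (velocity γ s) (velocity γ s) t = 0) :
    HasDerivWithinAt (fun r => (extChartAt 𝓘(ℝ, E) p (γ r), toCoord p (velocityLift γ s r)))
      (toCoord p (velocityLift γ s t), lagrangeSpray (L.coordFun p)
        (extChartAt 𝓘(ℝ, E) p (γ t), toCoord p (velocityLift γ s t))) s t := by
  have hz := ((contDiffWithinAt_chart (hγ t ht) hp).differentiableWithinAt
    (by simp)).hasDerivWithinAt
  rw [← toCoord_velocityLift (hs t ht) ((hγ t ht).mdifferentiableWithinAt (by simp)) hp] at hz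
  have hy : HasDerivWithinAt (fun r => toCoord p (velocityLift γ s r)) _ s t :=
    ((contDiffWithinAt_toCoord (contMDiffOn_velocityLift hs hγ t ht)
      hp).differentiableWithinAt (by simp)).hasDerivWithinAt
  refine hz.prodMk (hy.congr_deriv ?_)
  refine (eulerLagrange_eq_zero_iff (L.coordFun_nondegenerate p
    (L.mem_coordDomain (v := velocityLift γ s t) hp hA)) _).1 fun w => ?_
  -- The tangent vector with arbitrary components w is paired with D γ̇ = 0, so EL vanishes on every
  -- w.
  have := L.g_covDeriv hs hγ ht hA hp
    ((trivializationAt E (TangentSpace 𝓘(ℝ, E)) p).symmL ℝ (γ t) w)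
  rw [toCoord_symmL hp, hpar] at this
  have h0 := this.symm.trans (L.g_zero_right hA _)
  have h1 : L.curveEL p γ s t w = 0 := by linarith
  exact h1

/-- Two geodesic arcs with the same velocity at the common endpoint form a smooth curve. -/
theorem PseudoFinslerMetric.contMDiffAt_of_parallel {l c u : ℝ} (hlc : l < c) (hcu : c < u)
    (h₁ : ContMDiffOn 𝓘(ℝ, ℝ) 𝓘(ℝ, E) ∞ γ (Icc l c))
    (h₂ : ContMDiffOn 𝓘(ℝ, ℝ) 𝓘(ℝ, E) ∞ γ (Icc c u))
    (hA₁ : ∀ t ∈ Icc l c, velocityLift γ (Icc l c) t ∈ L.domain)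
    (hA₂ : ∀ t ∈ Icc c u, velocityLift γ (Icc c u) t ∈ L.domain)
    (hpar₁ : ∀ t ∈ Icc l c,
      L.covDeriv γ (Icc l c) (velocity γ (Icc l c)) (velocity γ (Icc l c)) t = 0)
    (hpar₂ : ∀ t ∈ Icc c u,
      L.covDeriv γ (Icc c u) (velocity γ (Icc c u)) (velocity γ (Icc c u)) t = 0)
    (hv : velocityLift (E := E) γ (Icc l c) c = velocityLift γ (Icc c u) c) :
    ContMDiffAt 𝓘(ℝ, ℝ) 𝓘(ℝ, E) ∞ γ c := by
  set p := γ c with hp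
  have hpc : γ c ∈ (chartAt E p).source := mem_chart_source E p
  have hcont : ContinuousOn γ (Ioo l u) := by
    have := h₁.continuousOn.union_of_isClosed h₂.continuousOn isClosed_Icc isClosed_Icc
    rw [Icc_union_Icc_eq_Icc hlc.le hcu.le] at this
    exact this.mono Ioo_subset_Icc_self
  set J := Ioo l u ∩ γ ⁻¹' (chartAt E p).source
  have hJ : IsOpen J := hcont.isOpen_inter_preimage isOpen_Ioo (chartAt E p).open_source
  have hcJ : c ∈ J := ⟨⟨hlc, hcu⟩, hpc⟩
  set x₁ : ℝ → E × E := fun r =>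
    (extChartAt 𝓘(ℝ, E) p (γ r), toCoord p (velocityLift γ (Icc l c) r))
  set x₂ : ℝ → E × E := fun r =>
    (extChartAt 𝓘(ℝ, E) p (γ r), toCoord p (velocityLift γ (Icc c u) r))
  set Φ : E × E → E × E := fun q => (q.2, lagrangeSpray (L.coordFun p) q)
  -- The glued phase curve. By `hv` both definitions agree at c, so each formula holds up to and
  -- including the break.
  set x : ℝ → E × E := fun r => if r ≤ c then x₁ r else x₂ r
  have hx₁ : ∀ r ≤ c, x r = x₁ r := fun r hr => if_pos hr
  have hx₂ : ∀ r ≥ c, x r = x₂ r := by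
    intro r hr
    rcases eq_or_lt_of_le hr with rfl | hlt
    · rw [hx₁ c le_rfl]; simp only [x₁, x₂, hv]
    · exact if_neg hlt.not_ge
  have hΦ : ContDiffOn ℝ ∞ Φ (L.coordDomain p) :=
    contDiffOn_snd.prodMk (contDiffOn_lagrangeSpray (L.isOpen_coordDomain p)
      (L.contDiffOn_coordFun p) fun q hq => L.coordFun_nondegenerate p hq)
  have hd₁ : ∀ r ∈ J, r ≤ c → HasDerivWithinAt x (Φ (x r)) (Iic c) r := by
    intro r hr hrc
    have hmem : r ∈ Icc l c := ⟨hr.1.1.le, hrc⟩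
    have hnhds : Icc l c ∈ 𝓝[Iic c] r := by
      rw [← Ici_inter_Iic]
      exact Filter.inter_mem (mem_nhdsWithin_of_mem_nhds (Ici_mem_nhds hr.1.1)) self_mem_nhdsWithin
    have := (L.hasDerivWithinAt_of_parallel (uniqueDiffOn_Icc hlc) h₁ hmem (hA₁ r hmem) hr.2
      (hpar₁ r hmem)).mono_of_mem_nhdsWithin hnhds
    rw [hx₁ r hrc]
    exact this.congr (fun y hy => hx₁ y hy) (hx₁ r hrc)
  have hd₂ : ∀ r ∈ J, c ≤ r → HasDerivWithinAt x (Φ (x r)) (Ici c) r := by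
    intro r hr hrc
    have hmem : r ∈ Icc c u := ⟨hrc, hr.1.2.le⟩
    have hnhds : Icc c u ∈ 𝓝[Ici c] r := by
      rw [← Ici_inter_Iic]
      exact Filter.inter_mem self_mem_nhdsWithin (mem_nhdsWithin_of_mem_nhds (Iic_mem_nhds hr.1.2))
    have := (L.hasDerivWithinAt_of_parallel (uniqueDiffOn_Icc hcu) h₂ hmem (hA₂ r hmem) hr.2
      (hpar₂ r hmem)).mono_of_mem_nhdsWithin hnhds
    rw [hx₂ r hrc]
    exact this.congr (fun y hy => hx₂ y hy) (hx₂ r hrc)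
  have hsmooth : ContDiffOn ℝ ∞ x J := by
    refine contDiffOn_of_hasDerivAt hΦ hJ ?_ ?_
    · intro r hr
      rcases le_total r c with hrc | hrc
      · rw [hx₁ r hrc]
        exact L.mem_coordDomain (v := velocityLift γ (Icc l c) r) hr.2 (hA₁ r ⟨hr.1.1.le, hrc⟩)
      · rw [hx₂ r hrc]
        exact L.mem_coordDomain (v := velocityLift γ (Icc c u) r) hr.2 (hA₂ r ⟨hrc, hr.1.2.le⟩)
    · intro r hr
      rcases lt_trichotomy r c with hrc | rfl | hrc
      · exact (hd₁ r hr hrc.le).hasDerivAt (Iic_mem_nhds hrc)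
      -- At the break both one-sided derivatives equal Φ at the common phase point, so x is
      -- differentiable there.
      · have := (hd₁ r hr le_rfl).union (hd₂ r hr le_rfl)
        rwa [Iic_union_Ici, hasDerivWithinAt_univ] at this
      · exact (hd₂ r hr hrc.le).hasDerivAt (Ici_mem_nhds hrc)
  have hfst : ∀ r, (x r).1 = extChartAt 𝓘(ℝ, E) p (γ r) := fun r => by
    simp only [x, x₁, x₂]; split_ifs <;> rfl
  have hz : ContMDiffAt 𝓘(ℝ, ℝ) 𝓘(ℝ, E) ∞ (fun r => (x r).1) c :=
    (contDiffAt_fst.comp c (hsmooth.contDiffAt (hJ.mem_nhds hcJ))).contMDiffAt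
  have hsymm : ContMDiffAt 𝓘(ℝ, E) 𝓘(ℝ, E) ∞ (extChartAt 𝓘(ℝ, E) p).symm (x c).1 := by
    rw [hfst]
    exact (contMDiffOn_extChartAt_symm p).contMDiffAt (extChartAt_target_mem_nhds' (by
      exact (extChartAt 𝓘(ℝ, E) p).map_source (by simpa using hpc)))
  refine (hsymm.comp c hz).congr_of_eventuallyEq ?_
  filter_upwards [hJ.mem_nhds hcJ] with r hr
  rw [Function.comp_apply, hfst, extChartAt_symm_apply hr.2]

end Regularity

/-! ### Corner condition and the passage from pieces to the whole interval. -/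

section Assembly

theorem velocity_piece {E : Type*} [NormedAddCommGroup E] [NormedSpace ℝ E]
    {M : Type*} [TopologicalSpace M] [ChartedSpace E M] {γ : ℝ → M} {a b : ℝ} {h : ℕ}
    (τ : Subdivision a b h)
    (hγ : ContMDiffOn 𝓘(ℝ, ℝ) 𝓘(ℝ, E) ∞ γ (Icc a b)) (i : Fin (h + 1)) {t : ℝ}
    (ht : t ∈ τ.piece i) : velocity (E := E) γ (τ.piece i) t = velocity γ (Icc a b) t :=
  velocity_mono ((hγ t (τ.piece_subset i ht)).mdifferentiableWithinAt (by simp))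
    (τ.uniqueDiffOn_piece i t ht) (τ.piece_subset i)

variable {E : Type*} [NormedAddCommGroup E] [NormedSpace ℝ E]
  {M : Type*} [TopologicalSpace M] [ChartedSpace E M] [IsManifold 𝓘(ℝ, E) ∞ M]
  {L : PseudoFinslerMetric E M} {a b : ℝ} {h : ℕ} {τ : Subdivision a b h} {γ : ℝ → M}

theorem Subdivision.pt_succ_castSucc_mem_piece (τ : Subdivision a b h) (i : Fin h) :
    τ.pt i.succ.castSucc ∈ τ.piece i.castSucc := by
  rw [← Fin.succ_castSucc]
  exact τ.pt_succ_mem_piece i.castSucc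

/-- Smoothness on [a, b] makes the two velocities at each break equal, so the break terms cancel,
and parallelism removes the integral. -/
theorem PseudoFinslerMetric.dE_of_isGeodesicOn (hγ : L.IsAdmissibleCurve τ γ)
    (hgeo : L.IsGeodesicOn γ a b) (W : ∀ t : ℝ, TangentSpace 𝓘(ℝ, E) (γ t)) :
    L.dE τ γ W = L.g (velocityLift γ (Icc a b) b) (velocity γ (Icc a b) b) (W b) -
      L.g (velocityLift γ (Icc a b) a) (velocity γ (Icc a b) a) (W a) := by
  have hv := fun i t => velocity_piece (E := E) (t := t) τ hgeo.smooth i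
  have hlift : ∀ i, ∀ t ∈ τ.piece i, velocityLift (E := E) γ (τ.piece i) t =
      velocityLift γ (Icc a b) t := fun i t ht => by
    rw [velocityLift, velocityLift, hv i t ht]
  have hend : ∀ i, ∀ t ∈ τ.piece i, ∀ w : TangentSpace 𝓘(ℝ, E) (γ t),
      L.g (velocityLift γ (τ.piece i) t) w (velocity γ (τ.piece i) t) =
        L.g (velocityLift γ (Icc a b) t) (velocity γ (Icc a b) t) w := fun i t ht w => by
    rw [velocityLift, velocityLift, hv i t ht]
    exact L.g_symm (hgeo.admissible t (τ.piece_subset i ht)) _ _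
  rw [L.dE_eq_of_parallel hγ fun i t ht => (L.covDeriv_velocity_mono (τ.uniqueDiffOn_piece i)
      (uniqueDiffOn_Icc τ.lt) (τ.piece_subset i) hgeo.smooth ht).trans
      (hgeo.parallel t (τ.piece_subset i ht)),
    Finset.sum_eq_zero, sub_zero, hend _ _ τ.left_mem_piece, hend _ _ τ.right_mem_piece]
  intro i _
  rw [hlift _ _ (τ.pt_succ_castSucc_mem_piece i), hlift _ _ (τ.pt_castSucc_mem_piece i.succ)]
  exact sub_self _

variable [FiniteDimensional ℝ E]
  {EP : Type*} [NormedAddCommGroup EP] [NormedSpace ℝ EP] {P : Set M} [ChartedSpace EP P]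
  {EQ : Type*} [NormedAddCommGroup EQ] [NormedSpace ℝ EQ] {Q : Set M} [ChartedSpace EQ Q]

/-- The Weierstrass-Erdmann corner condition: a field with arbitrary value w at one break and zero
at all other nodes reduces dE to the jump of the Legendre transform, evaluated on w. -/
theorem PseudoFinslerMetric.IsCriticalPoint.velocityLift_eq
    (hcrit : L.IsCriticalPoint τ (EP := EP) P (EQ := EQ) Q γ) (hγ : L.IsCurveJoining τ P Q γ)
    (hL : InjOn L.legendre L.domain) (i : Fin h) :
    velocityLift (E := E) γ (τ.piece i.castSucc) (τ.pt i.succ.castSucc) =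
      velocityLift γ (τ.piece i.succ) (τ.pt i.succ.castSucc) := by
  refine hL (hγ.admissible _ _ (τ.pt_succ_castSucc_mem_piece i))
    (hγ.admissible _ _ (τ.pt_castSucc_mem_piece i.succ)) ?_
  refine congrArg (Sigma.mk (γ (τ.pt i.succ.castSucc))) (funext fun w => ?_)
  obtain ⟨W, hW, hWc, hW0⟩ := exists_field_at_pt hγ.smooth i.succ.castSucc rfl w
  have hWa : W a = 0 := by
    have := hW0 0 (by simp [Fin.ext_iff])
    rwa [τ.first] at this
  have hWb : W b = 0 := by
    have := hW0 (Fin.last _) (by have := i.isLt; simp [Fin.ext_iff]; omega)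
    rwa [τ.last] at this
  have hdE := hcrit W hW (by rw [hWa]; exact zero_mem_tangentSpaceOf hγ.left_mem)
    (by rw [hWb]; exact zero_mem_tangentSpaceOf hγ.right_mem)
  rw [L.dE_eq_of_parallel hγ.toIsAdmissibleCurve fun i t ht => hcrit.parallel hγ i ht] at hdE
  have h1 : L.g (velocityLift γ (τ.piece (Fin.last h)) b) (W b)
      (velocity γ (τ.piece (Fin.last h)) b) = 0 := by
    rw [hWb]; exact L.g_zero_left (hγ.admissible _ _ τ.right_mem_piece) _
  have h2 : L.g (velocityLift γ (τ.piece 0) a) (W a) (velocity γ (τ.piece 0) a) = 0 := by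
    rw [hWa]; exact L.g_zero_left (hγ.admissible _ _ τ.left_mem_piece) _
  rw [h1, h2, Finset.sum_eq_single i, hWc] at hdE
  · have : ((L.legendre (velocityLift γ (τ.piece i.succ) (τ.pt i.succ.castSucc))).2 w
        - (L.legendre (velocityLift γ (τ.piece i.castSucc) (τ.pt i.succ.castSucc))).2 w) = 0 := by
      linarith
    exact (sub_eq_zero.1 this).symm
  · intro j _ hj
    rw [hW0 j.succ.castSucc (fun hjk => hj (by simpa using hjk))]
    have e1 := L.g_zero_right (hγ.admissible j.succ _ (τ.pt_castSucc_mem_piece j.succ))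
      (velocity γ (τ.piece j.succ) (τ.pt j.succ.castSucc))
    have e2 := L.g_zero_right (hγ.admissible j.castSucc _ (τ.pt_succ_castSucc_mem_piece j))
      (velocity γ (τ.piece j.castSucc) (τ.pt j.succ.castSucc))
    exact (congrArg₂ (· - ·) e1 e2).trans (sub_zero 0)
  · exact fun h => absurd (Finset.mem_univ i) h

/-- At a break the two adjacent geodesic arcs are glued; at every other time a single piece is
already a neighbourhood within [a, b]. -/
theorem PseudoFinslerMetric.IsCriticalPoint.contMDiffOn
    (hcrit : L.IsCriticalPoint τ (EP := EP) P (EQ := EQ) Q γ) (hγ : L.IsCurveJoining τ P Q γ)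
    (hL : InjOn L.legendre L.domain) : ContMDiffOn 𝓘(ℝ, ℝ) 𝓘(ℝ, E) ∞ γ (Icc a b) := by
  have hbreak : ∀ i : Fin h, ContMDiffAt 𝓘(ℝ, ℝ) 𝓘(ℝ, E) ∞ γ (τ.pt i.succ.castSucc) := by
    intro i
    have hpc : τ.piece i.castSucc = Icc (τ.pt i.castSucc.castSucc) (τ.pt i.succ.castSucc) := by
      rw [Subdivision.piece, Fin.succ_castSucc]
    have hlc := τ.castSucc_lt_succ i.castSucc
    rw [Fin.succ_castSucc] at hlc
    have h₁ := hγ.smooth i.castSucc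
    have hA₁ := hγ.admissible i.castSucc
    have hpar₁ := fun t (ht : t ∈ τ.piece i.castSucc) => hcrit.parallel hγ i.castSucc ht
    have hv := hcrit.velocityLift_eq hγ hL i
    rw [hpc] at h₁ hA₁ hpar₁ hv
    exact L.contMDiffAt_of_parallel hlc (τ.castSucc_lt_succ i.succ) h₁ (hγ.smooth i.succ) hA₁
      (hγ.admissible i.succ) hpar₁ (fun t ht => hcrit.parallel hγ i.succ ht) hv
  intro t ht
  obtain ⟨i, hi⟩ := τ.exists_mem_piece ht
  -- The left end of a piece is a for piece 0 and a break otherwise; right ends are treated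
  -- symmetrically below.
  rcases eq_or_lt_of_le hi.1 with hl | hl
  · cases i using Fin.cases with
    | zero =>
      refine (hγ.smooth 0 t hi).mono_of_mem_nhdsWithin ?_
      rw [Fin.castSucc_zero, τ.first] at hl
      subst hl
      have h1 : a < τ.pt (Fin.succ 0) := by
        have := τ.castSucc_lt_succ 0
        rwa [Fin.castSucc_zero, τ.first] at this
      rw [Subdivision.piece, Fin.castSucc_zero, τ.first, ← Ici_inter_Iic]
      exact Filter.inter_mem (Filter.mem_of_superset self_mem_nhdsWithin Icc_subset_Ici_self)
        (mem_nhdsWithin_of_mem_nhds (Iic_mem_nhds h1))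
    | succ k => exact (hl ▸ hbreak k).contMDiffWithinAt
  rcases eq_or_lt_of_le hi.2 with hr | hr
  · cases i using Fin.lastCases with
    | last =>
      refine (hγ.smooth _ t hi).mono_of_mem_nhdsWithin ?_
      rw [Fin.succ_last, τ.last] at hr
      subst hr
      rw [Subdivision.piece, Fin.succ_last, τ.last, ← Ici_inter_Iic]
      exact Filter.inter_mem (mem_nhdsWithin_of_mem_nhds (Ici_mem_nhds hl))
        (Filter.mem_of_superset self_mem_nhdsWithin Icc_subset_Iic_self)
    | cast k =>
      rw [Fin.succ_castSucc] at hr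
      exact (hr ▸ hbreak k).contMDiffWithinAt
  · exact ((hγ.smooth i t hi).contMDiffAt (Icc_mem_nhds hl hr)).contMDiffWithinAt

theorem PseudoFinslerMetric.IsCriticalPoint.isGeodesicOn
    (hcrit : L.IsCriticalPoint τ (EP := EP) P (EQ := EQ) Q γ) (hγ : L.IsCurveJoining τ P Q γ)
    (hL : InjOn L.legendre L.domain) : L.IsGeodesicOn γ a b := by
  have hsmooth := hcrit.contMDiffOn hγ hL
  refine ⟨hsmooth, fun t ht => ?_, fun t ht => ?_⟩
  · obtain ⟨i, hi⟩ := τ.exists_mem_piece ht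
    rw [velocityLift, ← velocity_piece τ hsmooth i hi]
    exact hγ.admissible i t hi
  · obtain ⟨i, hi⟩ := τ.exists_mem_piece ht
    exact (L.covDeriv_velocity_mono (τ.uniqueDiffOn_piece i) (uniqueDiffOn_Icc τ.lt)
      (τ.piece_subset i) hsmooth hi).symm.trans (hcrit.parallel hγ i hi)

end Assembly

end

end PseudoFinsler

/-! ### The equivalence, with the endpoint conditions. -/

theorem corollary3p7
    {E : Type*} [NormedAddCommGroup E] [NormedSpace ℝ E] [FiniteDimensional ℝ E]
    {M : Type*} [TopologicalSpace M] [ChartedSpace E M] [IsManifold 𝓘(ℝ, E) ∞ M]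
    (L : PseudoFinsler.PseudoFinslerMetric E M)
    {EP : Type*} [NormedAddCommGroup EP] [NormedSpace ℝ EP] [FiniteDimensional ℝ EP]
    (P : Set M) [ChartedSpace EP P] [IsManifold 𝓘(ℝ, EP) ∞ P]
    (hP : Manifold.IsSmoothEmbedding 𝓘(ℝ, EP) 𝓘(ℝ, E) ∞ (Subtype.val : P → M))
    {EQ : Type*} [NormedAddCommGroup EQ] [NormedSpace ℝ EQ] [FiniteDimensional ℝ EQ]
    (Q : Set M) [ChartedSpace EQ Q] [IsManifold 𝓘(ℝ, EQ) ∞ Q]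
    (hQ : Manifold.IsSmoothEmbedding 𝓘(ℝ, EQ) 𝓘(ℝ, E) ∞ (Subtype.val : Q → M))
    (hL : Set.InjOn L.legendre L.domain)
    {a b : ℝ} {h : ℕ} (τ : PseudoFinsler.Subdivision a b h)
    (γ : ℝ → M) (hγ : L.IsCurveJoining τ P Q γ) :
    L.IsCriticalPoint τ (EP := EP) P (EQ := EQ) Q γ ↔
      (L.IsGeodesicOn γ a b ∧
        (∀ w ∈ PseudoFinsler.tangentSpaceOf (EP := EP) P (γ a),
          L.g (PseudoFinsler.velocityLift γ (Set.Icc a b) a)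
            (PseudoFinsler.velocity γ (Set.Icc a b) a) w = 0) ∧
        (∀ w ∈ PseudoFinsler.tangentSpaceOf (EP := EQ) Q (γ b),
          L.g (PseudoFinsler.velocityLift γ (Set.Icc a b) b)
            (PseudoFinsler.velocity γ (Set.Icc a b) b) w = 0)) := by
  constructor
  · intro hcrit
    have hgeo := hcrit.isGeodesicOn hγ hL
    have hends := L.dE_of_isGeodesicOn hγ.toIsAdmissibleCurve hgeo
    have hab := τ.lt
    refine ⟨hgeo, fun w hw => ?_, fun w hw => ?_⟩
    -- A field with value w at a and zero at b is admissible, and it leaves only the endpoint term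
    -- at a. The condition at b is obtained in the same way.
    · obtain ⟨W, hW, hWa, hW0⟩ := PseudoFinsler.exists_field_at_pt hγ.smooth 0 τ.first w
      have hWb : W b = 0 := by
        have := hW0 (Fin.last _) (Fin.last_pos).ne'
        rwa [τ.last] at this
      have hdE := hcrit W hW (by rwa [hWa])
        (by rw [hWb]; exact PseudoFinsler.zero_mem_tangentSpaceOf hγ.right_mem)
      rw [hends, hWa, hWb] at hdE
      have h0 := L.g_zero_right (hgeo.admissible b (Set.right_mem_Icc.2 hab.le))
        (PseudoFinsler.velocity γ (Set.Icc a b) b)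
      linarith [hdE.symm.trans (congrArg (· - _) h0)]
    · obtain ⟨W, hW, hWb, hW0⟩ := PseudoFinsler.exists_field_at_pt hγ.smooth (Fin.last _) τ.last w
      have hWa : W a = 0 := by
        have := hW0 0 (Fin.last_pos).ne
        rwa [τ.first] at this
      have hdE := hcrit W hW
        (by rw [hWa]; exact PseudoFinsler.zero_mem_tangentSpaceOf hγ.left_mem) (by rwa [hWb])
      rw [hends, hWa, hWb] at hdE
      have h0 := L.g_zero_right (hgeo.admissible a (Set.left_mem_Icc.2 hab.le))
        (PseudoFinsler.velocity γ (Set.Icc a b) a)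
      linarith [hdE.symm.trans (congrArg (_ - ·) h0)]
  · rintro ⟨hgeo, hP', hQ'⟩ W - hWa hWb
    rw [L.dE_of_isGeodesicOn hγ.toIsAdmissibleCurve hgeo, hP' _ hWa, hQ' _ hWb, sub_zero]
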